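/- **Setting.** Write $\hat f(k)=(2\pi)^{-3/2}\int_{\mathbb R^3}f(x)e^{-ik\cdot x}\,dx$, extended to tempered distributions. Let $\Lambda>0$ (ultraviolet cut-off) and $\alpha>0$ (coupling constant), and let $\mathfrak H_\Lambda=\{f\in L^2(\mathbb R^3,\mathbb C^4):\ \operatorname{supp}\hat f\subset B(0,\Lambda)\}$. On $\mathfrak H_\Lambda$ let $D^0=-i\boldsymbol\alpha\cdot\nabla+\beta$ be the free Dirac operator ($\alpha_1,\alpha_2,\alpha_3,\beta$ the standard $4\times4$ Dirac matrices), $P^0_-=\chi_{(-\infty,0)}(D^0)$, $P^0_+=1-P^0_-$, and for a bounded operator $Q$ put $Q_{\pm\pm}=P^0_\pm QP^0_\pm$. Let $$\mathcal K=\{Q \text{ Hilbert–Schmidt on }\mathfrak H_\Lambda:\ Q_{++},Q_{--}\text{ trace class},\ Q=Q^*,\ -P^0_-\le Q\le 1-P^0_-\},$$ $\operatorname{tr}_0(A)=\operatorname{tr}(A_{++}+A_{--})$, and $\rho_Q(x)=\operatorname{tr}_{\mathbb C^4}Q(x,x)$, where $Q(x,y)$ is the (smooth) $4\times 4$ matrix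 kernel of $Q$. The Coulomb space $\mathcal C$ consists of the tempered distributions $f$ such that $\hat f$ is a function with $\int|\hat f(k)|^2|k|^{-2}dk<\infty$, with the Coulomb inner product $$D(f,g)=4\pi\int_{\mathbb R^3}\frac{\hat f(k)\overline{\hat g(k)}}{|k|^2}\,dk .$$ For real $\nu\in\mathcal C$ and $Z>0$ the reduced Bogoliubov–Dirac–Fock energy and the ground-state energy are $$\mathcal E^{Z\nu}(Q)=\operatorname{tr}_0(D^0Q)-\alpha D(\rho_Q,Z\nu)+\tfrac{\alpha}{2}D(\rho_Q,\rho_Q),\qquad E(Z)=\inf\{\mathcal E^{Z\nu}(Q):\ Q\in\mathcal K\}.$$ **Proposition 3.2.** Let $c_1=2^{-23/3}3^{1/3}\pi^{-4/3}$. There is a function $\tilde Z_1=\tilde Z_1(\Lambda,\alpha,s,M)>0$ of four real parameters such that the following holds. Let $\alpha>0$, $\Lambda>0$, and let $\nu\in\mathcal C\cap L^1(\mathbb R^3,\mathbb R)$ satisfy $\int|x||\nu(x)|\,dx<\infty$, $\int|\nu|=1$ and $q:=\int\nu\neq0$. Then $$E(Z)\le-\frac{c_1}{2}\,\alpha\,\Lambda\,|q|^{5/3}Z^{5/3}\qquad\text{for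 all } Z>\tilde Z_1\Bigl(\Lambda,\alpha,|q|,\int|x||\nu(x)|\,dx\Bigr).$$ -/

import Mathlib

noncomputable section

open MeasureTheory FourierTransform Matrix
open scoped SchwartzMap ENNReal

namespace RBDF

/-! ## Hilbert–Schmidt and trace-class operators -/

section Schatten

variable {H : Type*} [NormedAddCommGroup H] [InnerProductSpace ℂ H] [CompleteSpace H]

variable (H) in
/-- The index set of some fixed Hilbert basis of `H`. -/
def basisIndex : Set H := (exists_hilbertBasis ℂ H).choose

variable (H) in
/-- Some fixed Hilbert basis of `H`. The notions below do not depend on this choice. -/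
def basis : HilbertBasis (basisIndex H) ℂ H := (exists_hilbertBasis ℂ H).choose_spec.choose

/-- `A` is a Hilbert–Schmidt operator: `tr (|A|²) = ∑ ‖A eᵢ‖² < ∞`. -/
def IsHilbertSchmidt (A : H →L[ℂ] H) : Prop :=
  Summable fun i => ‖A (basis H i)‖ ^ 2

/-- `A` is a trace-class operator: `tr |A| = ∑ ⟨eᵢ, |A| eᵢ⟩ < ∞`, where `|A| = (A* A)^{1/2}`. -/
def IsTraceClass (A : H →L[ℂ] H) : Prop :=
  Summable fun i => (inner ℂ (basis H i) (CFC.abs A (basis H i))).re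

/-- The trace `∑ ⟨eᵢ, A eᵢ⟩` of a (trace-class) operator. -/
def trace (A : H →L[ℂ] H) : ℂ := ∑' i, inner ℂ (basis H i) (A (basis H i))

end Schatten

/-! ## The one-particle space with ultraviolet cut-off

Mathlib's Fourier transform is `𝓕 f ξ = ∫ f x e^{-2πi x·ξ} dx`, so its variable `ξ` and the momentum
`p` are related by `p = 2πξ`. -/

/-- Physical space `ℝ³` (also used for momenta). -/
abbrev R3 : Type := EuclideanSpace ℝ (Fin 3)

/-- The spinor space `ℂ⁴`. -/
abbrev Spinor : Type := EuclideanSpace ℂ (Fin 4)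

/-- `L²(ℝ³, ℂ⁴)`. -/
abbrev L2 : Type := Lp Spinor 2 (volume : Measure R3)

/-- The set of all `ξ` whose momentum `p = 2πξ` satisfies `|p| ≤ Λ`. -/
def freqBall (Λ : ℝ) : Set R3 := Metric.closedBall 0 (Λ / (2 * Real.pi))

/-- The space of all `f ∈ L²(ℝ³, ℂ⁴)` whose Fourier transform is supported in the ball
`|p| ≤ Λ`. -/
def cutoffSpace (Λ : ℝ) : Submodule ℂ L2 where
  carrier := {f | ∀ᵐ ξ ∂(volume : Measure R3), ξ ∉ freqBall Λ → (𝓕 f : L2) ξ = 0}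
  add_mem' := by
    intro f g hf hg
    simp only [Set.mem_ofPred_eq, FourierTransform.fourier_add] at *
    filter_upwards [hf, hg, Lp.coeFn_add (𝓕 f : L2) (𝓕 g : L2)] with ξ h1 h2 h3 hξ
    rw [h3, Pi.add_apply, h1 hξ, h2 hξ, add_zero]
  zero_mem' := by
    have h : (𝓕 (0 : L2) : L2) = 0 := (Lp.fourierTransformₗᵢ R3 Spinor).map_zero
    simp only [Set.mem_ofPred_eq, h]
    filter_upwards [Lp.coeFn_zero Spinor 2 (volume : Measure R3)] with ξ h1 _
    rw [h1, Pi.zero_apply]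
  smul_mem' := by
    intro c f hf
    simp only [Set.mem_ofPred_eq, FourierTransform.fourier_smul] at *
    filter_upwards [hf, Lp.coeFn_smul c (𝓕 f : L2)] with ξ h1 h3 hξ
    simp [h3, h1 hξ]

theorem mem_cutoffSpace {Λ : ℝ} {f : L2} : f ∈ cutoffSpace Λ ↔
    ∀ᵐ ξ ∂(volume : Measure R3), ξ ∉ freqBall Λ → (𝓕 f : L2) ξ = 0 := Iff.rfl

theorem measurableSet_freqBall (Λ : ℝ) : MeasurableSet (freqBall Λ) :=
  Metric.isClosed_closedBall.measurableSet

theorem isClosed_cutoffSpace (Λ : ℝ) : IsClosed (cutoffSpace Λ : Set L2) := by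
  let T : L2 →L[ℂ] _ :=
    (LpToLpRestrictCLM R3 Spinor ℂ (volume : Measure R3) 2 (freqBall Λ)ᶜ).comp
      (fourierCLM ℂ L2)
  have h : (cutoffSpace Λ : Set L2) = T ⁻¹' {0} := by
    ext f
    have h1 := LpToLpRestrictCLM_coeFn (μ := (volume : Measure R3)) (p := 2) ℂ (freqBall Λ)ᶜ
      (𝓕 f : L2)
    have h2 : T f = LpToLpRestrictCLM R3 Spinor ℂ (volume : Measure R3) 2 (freqBall Λ)ᶜ
      (𝓕 f : L2) := rfl
    have h3 := ae_restrict_iff' (μ := (volume : Measure R3))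
      (p := fun ξ => (𝓕 f : L2) ξ = 0) (measurableSet_freqBall Λ).compl
    rw [SetLike.mem_coe, mem_cutoffSpace, Set.mem_preimage, Set.mem_singleton_iff, h2]
    refine h3.symm.trans ?_
    rw [Lp.eq_zero_iff_ae_eq_zero]
    constructor
    · intro h
      exact h1.trans h
    · intro h
      exact h1.symm.trans h
  rw [h]
  exact isClosed_singleton.preimage T.continuous

instance (Λ : ℝ) : CompleteSpace (cutoffSpace Λ) :=
  (isClosed_cutoffSpace Λ).completeSpace_coe

/-! ## Fourier multipliers, the free Dirac operator and its negative spectral projection -/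

/-- A matrix-valued symbol `m(p)`, cut off to the ball `|p| ≤ Λ`, as a function of `ξ = p / 2π`. -/
def cutSymbol (Λ : ℝ) (m : C(R3, Matrix (Fin 4) (Fin 4) ℂ)) : R3 → (Spinor →L[ℂ] Spinor) :=
  (freqBall Λ).indicator fun ξ => toEuclideanCLM (𝕜 := ℂ) (m ((2 * Real.pi) • ξ))

theorem memLp_cutSymbol (Λ : ℝ) (m : C(R3, Matrix (Fin 4) (Fin 4) ℂ)) :
    MemLp (cutSymbol Λ m) ∞ (volume : Measure R3) := by
  have hc : Continuous fun ξ : R3 =>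
      (toEuclideanCLM (n := Fin 4) (𝕜 := ℂ) (m ((2 * Real.pi) • ξ))) := by
    have : Continuous fun M : Matrix (Fin 4) (Fin 4) ℂ =>
        (toEuclideanCLM (n := Fin 4) (𝕜 := ℂ) M) :=
      LinearMap.continuous_of_finiteDimensional
        ((toEuclideanCLM (n := Fin 4) (𝕜 := ℂ)).toAlgEquiv.toLinearMap)
    fun_prop
  obtain ⟨C, hC⟩ := (isCompact_closedBall (0 : R3) (Λ / (2 * Real.pi))).exists_bound_of_continuousOn
    hc.continuousOn
  refine memLp_top_of_bound
    (hc.aestronglyMeasurable.indicator (measurableSet_freqBall Λ)) (max C 0) (.of_forall fun ξ => ?_)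
  by_cases h : ξ ∈ freqBall Λ
  · rw [cutSymbol, Set.indicator_of_mem h]
    exact (hC ξ h).trans (le_max_left _ _)
  · rw [cutSymbol, Set.indicator_of_notMem h]
    simp

/-- The operator `f ↦ 𝓕⁻¹ (m(p) 1_{|p| ≤ Λ} 𝓕 f)` on `L²(ℝ³, ℂ⁴)`. -/
def multiplierL2 (Λ : ℝ) (m : C(R3, Matrix (Fin 4) (Fin 4) ℂ)) : L2 →L[ℂ] L2 :=
  (fourierInvCLM ℂ L2).comp
    ((((ContinuousLinearMap.id ℂ (Spinor →L[ℂ] Spinor)).holderL volume ∞ 2 2)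
      (memLp_cutSymbol Λ m).toLp).comp (fourierCLM ℂ L2))

theorem fourier_multiplierL2 (Λ : ℝ) (m : C(R3, Matrix (Fin 4) (Fin 4) ℂ)) (f : L2) :
    (𝓕 (multiplierL2 Λ m f) : L2) =ᵐ[volume] fun ξ => cutSymbol Λ m ξ ((𝓕 f : L2) ξ) := by
  have h : (𝓕 (multiplierL2 Λ m f) : L2) =
      (ContinuousLinearMap.id ℂ (Spinor →L[ℂ] Spinor)).holder 2
        (memLp_cutSymbol Λ m).toLp (𝓕 f : L2) :=
    FourierTransform.fourier_fourierInv_eq _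
  rw [h]
  filter_upwards [ContinuousLinearMap.coeFn_holder (r := 2)
    (ContinuousLinearMap.id ℂ (Spinor →L[ℂ] Spinor)) (memLp_cutSymbol Λ m).toLp (𝓕 f : L2),
    (memLp_cutSymbol Λ m).coeFn_toLp] with ξ h1 h2
  rw [h1, h2]
  rfl

/-- The Fourier multiplier with symbol `m(p)`, as a bounded operator on the cut-off space. -/
def multiplier (Λ : ℝ) (m : C(R3, Matrix (Fin 4) (Fin 4) ℂ)) :
    cutoffSpace Λ →L[ℂ] cutoffSpace Λ :=
  ((multiplierL2 Λ m).comp (cutoffSpace Λ).subtypeL).codRestrict (cutoffSpace Λ) (by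
    intro f
    rw [mem_cutoffSpace]
    filter_upwards [fourier_multiplierL2 Λ m f] with ξ h hξ
    simp only [ContinuousLinearMap.comp_apply, Submodule.subtypeL_apply]
    rw [h, cutSymbol, Set.indicator_of_notMem hξ]
    simp)

/-- The Dirac matrices `α₁, α₂, α₃`. -/
def diracAlpha : Fin 3 → Matrix (Fin 4) (Fin 4) ℂ :=
  ![!![0, 0, 0, 1; 0, 0, 1, 0; 0, 1, 0, 0; 1, 0, 0, 0],
    !![0, 0, 0, -Complex.I; 0, 0, Complex.I, 0; 0, -Complex.I, 0, 0; Complex.I, 0, 0, 0],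
    !![0, 0, 1, 0; 0, 0, 0, -1; 1, 0, 0, 0; 0, -1, 0, 0]]

/-- The Dirac matrix `β`. -/
def diracBeta : Matrix (Fin 4) (Fin 4) ℂ :=
  !![1, 0, 0, 0; 0, 1, 0, 0; 0, 0, -1, 0; 0, 0, 0, -1]

/-- The symbol `D⁰(p) = α·p + β` of the free Dirac operator `D⁰ = -i α·∇ + β`. -/
def diracSymbol : C(R3, Matrix (Fin 4) (Fin 4) ℂ) where
  toFun p := ∑ i, (p i : ℂ) • diracAlpha i + diracBeta
  continuous_toFun := by fun_prop

/-- The symbol `P⁰₋(p) = (1 - D⁰(p) / √(1+|p|²)) / 2` of the negative spectral projection. -/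
def negSymbol : C(R3, Matrix (Fin 4) (Fin 4) ℂ) where
  toFun p := (1 / 2 : ℂ) • (1 - ((Real.sqrt (1 + ‖p‖ ^ 2))⁻¹ : ℂ) • diracSymbol p)
  continuous_toFun := by
    have h : ∀ p : R3, (Real.sqrt (1 + ‖p‖ ^ 2) : ℂ) ≠ 0 := fun p => by
      have : 0 < Real.sqrt (1 + ‖p‖ ^ 2) := by positivity
      exact_mod_cast this.ne'
    have h2 : Continuous fun p : R3 => ((Real.sqrt (1 + ‖p‖ ^ 2) : ℂ))⁻¹ :=
      Continuous.inv₀ (by fun_prop) h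
    fun_prop

theorem diracSymbol_isHermitian (p : R3) : (diracSymbol p).IsHermitian := by
  ext i j
  fin_cases i <;> fin_cases j <;>
    simp [diracSymbol, diracAlpha, diracBeta, Fin.sum_univ_three, Matrix.conjTranspose_apply]

theorem diracSymbol_mul_self (p : R3) :
    diracSymbol p * diracSymbol p = ((1 + ‖p‖ ^ 2 : ℝ) : ℂ) • 1 := by
  have hI : Complex.I ^ 2 = -1 := Complex.I_sq
  rw [EuclideanSpace.norm_sq_eq]
  ext i j
  fin_cases i <;> fin_cases j <;>
    (simp [diracSymbol, diracAlpha, diracBeta, Fin.sum_univ_three, Matrix.mul_apply,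
      Fin.sum_univ_four]; try ring_nf; try simp [hI]; try ring)

/-- `P⁰₋(p)` is a Hermitian matrix. -/
theorem negSymbol_isHermitian (p : R3) : (negSymbol p).IsHermitian := by
  have h := (diracSymbol_isHermitian p).eq
  simp only [negSymbol, ContinuousMap.coe_mk, Matrix.IsHermitian, conjTranspose_smul,
    conjTranspose_sub, conjTranspose_one, h]
  simp

/-- `P⁰₋(p)` is idempotent. -/
theorem negSymbol_mul_self (p : R3) : negSymbol p * negSymbol p = negSymbol p := by
  have h := diracSymbol_mul_self p
  have hs : (Real.sqrt (1 + ‖p‖ ^ 2) : ℂ) * Real.sqrt (1 + ‖p‖ ^ 2) =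
      ((1 + ‖p‖ ^ 2 : ℝ) : ℂ) := by
    exact_mod_cast Real.mul_self_sqrt (by positivity)
  have h0 : (Real.sqrt (1 + ‖p‖ ^ 2) : ℂ) ≠ 0 := by
    have : 0 < Real.sqrt (1 + ‖p‖ ^ 2) := by positivity
    exact_mod_cast this.ne'
  rw [← hs] at h
  simp only [negSymbol, ContinuousMap.coe_mk]
  generalize (Real.sqrt (1 + ‖p‖ ^ 2) : ℂ) = s at *
  simp only [smul_mul_assoc, mul_smul_comm, mul_sub, sub_mul, mul_one, one_mul, h, smul_smul]
  have h1 : s⁻¹ * (s * s) = s := by field_simp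
  have h2 : (s⁻¹ * (1 / 2)) • (diracSymbol p - s • (1 : Matrix (Fin 4) (Fin 4) ℂ)) =
      (1 / 2 : ℂ) • (s⁻¹ • diracSymbol p) - (1 / 2 : ℂ) • 1 := by
    rw [smul_sub, smul_smul, smul_smul, mul_comm s⁻¹, mul_assoc, inv_mul_cancel₀ h0, mul_one]
  rw [h1, h2]
  module

/-- `D⁰(p) = √(1+|p|²) (P⁰₊(p) - P⁰₋(p))` with `P⁰₊ = 1 - P⁰₋`. -/
theorem diracSymbol_eq (p : R3) :
    diracSymbol p = (Real.sqrt (1 + ‖p‖ ^ 2) : ℂ) • ((1 - negSymbol p) - negSymbol p) := by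
  have h0 : (Real.sqrt (1 + ‖p‖ ^ 2) : ℂ) ≠ 0 := by
    have : 0 < Real.sqrt (1 + ‖p‖ ^ 2) := by positivity
    exact_mod_cast this.ne'
  simp only [negSymbol, ContinuousMap.coe_mk]
  generalize (Real.sqrt (1 + ‖p‖ ^ 2) : ℂ) = s at *
  have : (1 - (1 / 2 : ℂ) • (1 - s⁻¹ • diracSymbol p)) - (1 / 2 : ℂ) • (1 - s⁻¹ • diracSymbol p)
      = s⁻¹ • diracSymbol p := by module
  rw [this, smul_smul, mul_inv_cancel₀ h0, one_smul]

/-- The free Dirac operator `D⁰` on the cut-off space. -/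
def dirac (Λ : ℝ) : cutoffSpace Λ →L[ℂ] cutoffSpace Λ := multiplier Λ diracSymbol

/-- The free vacuum `P⁰₋ = χ_{(-∞,0)}(D⁰)`. -/
def Pneg (Λ : ℝ) : cutoffSpace Λ →L[ℂ] cutoffSpace Λ := multiplier Λ negSymbol

/-- `P⁰₊ = 1 - P⁰₋`. -/
def Ppos (Λ : ℝ) : cutoffSpace Λ →L[ℂ] cutoffSpace Λ := 1 - Pneg Λ

/-- The block `Q₊₊ = P⁰₊ Q P⁰₊`. -/
def blockPP {Λ : ℝ} (Q : cutoffSpace Λ →L[ℂ] cutoffSpace Λ) : cutoffSpace Λ →L[ℂ] cutoffSpace Λ :=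
  Ppos Λ * Q * Ppos Λ

/-- The block `Q₋₋ = P⁰₋ Q P⁰₋`. -/
def blockNN {Λ : ℝ} (Q : cutoffSpace Λ →L[ℂ] cutoffSpace Λ) : cutoffSpace Λ →L[ℂ] cutoffSpace Λ :=
  Pneg Λ * Q * Pneg Λ

/-- The generalized trace `tr₀ Q = tr (Q₊₊ + Q₋₋)`. -/
def genTrace {Λ : ℝ} (Q : cutoffSpace Λ →L[ℂ] cutoffSpace Λ) : ℂ := trace (blockPP Q + blockNN Q)

/-- The variational set `𝒦`: all `Q` that are Hilbert–Schmidt with `Q₊₊`, `Q₋₋` trace class,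
self-adjoint, and satisfy `-P⁰₋ ≤ Q ≤ 1 - P⁰₋`. -/
def variationalSet (Λ : ℝ) : Set (cutoffSpace Λ →L[ℂ] cutoffSpace Λ) :=
  {Q | (IsHilbertSchmidt Q ∧ IsTraceClass (blockPP Q) ∧ IsTraceClass (blockNN Q)) ∧
    IsSelfAdjoint Q ∧ -Pneg Λ ≤ Q ∧ Q ≤ 1 - Pneg Λ}

/-! ## The integral kernel and the density of an operator -/

/-- The Fourier transform `ξ ↦ 1_{|p| ≤ Λ} e^{-2πi x·ξ} eᵢ` of the evaluation vector at `x`. -/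
def evalHat (Λ : ℝ) (x : R3) (i : Fin 4) : R3 → Spinor :=
  (freqBall Λ).indicator fun ξ =>
    Complex.exp ((-(2 * Real.pi * inner ℝ x ξ) : ℝ) * Complex.I) • EuclideanSpace.single i (1 : ℂ)

theorem memLp_evalHat (Λ : ℝ) (x : R3) (i : Fin 4) :
    MemLp (evalHat Λ x i) 2 (volume : Measure R3) := by
  have hm : Continuous fun ξ : R3 =>
      Complex.exp ((-(2 * Real.pi * inner ℝ x ξ) : ℝ) * Complex.I) •
        (EuclideanSpace.single i (1 : ℂ) : Spinor) := by fun_prop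
  rw [evalHat, memLp_indicator_iff_restrict (measurableSet_freqBall Λ)]
  have : IsFiniteMeasure ((volume : Measure R3).restrict (freqBall Λ)) :=
    ⟨by
      rw [Measure.restrict_apply_univ]
      exact (isCompact_closedBall (0 : R3) (Λ / (2 * Real.pi))).measure_lt_top⟩
  refine MemLp.of_bound hm.aestronglyMeasurable 1 (.of_forall fun ξ => ?_)
  rw [norm_smul, Complex.norm_exp_ofReal_mul_I]
  simp

/-- The evaluation vector at `x`: the element `E` of the cut-off space such that
`⟨E, f⟩ = f(x)ᵢ` for all `f` in it. -/
def evalVec (Λ : ℝ) (x : R3) (i : Fin 4) : cutoffSpace Λ :=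
  ⟨(𝓕⁻ ((memLp_evalHat Λ x i).toLp : L2) : L2), by
    rw [mem_cutoffSpace, FourierTransform.fourier_fourierInv_eq]
    filter_upwards [(memLp_evalHat Λ x i).coeFn_toLp] with ξ h hξ
    rw [h, evalHat, Set.indicator_of_notMem hξ]⟩

/-- The `4 × 4` matrix kernel `Q(x, y)` of an operator `Q`. -/
def kernel {Λ : ℝ} (Q : cutoffSpace Λ →L[ℂ] cutoffSpace Λ) (x y : R3) :
    Matrix (Fin 4) (Fin 4) ℂ :=
  Matrix.of fun i j => inner ℂ (evalVec Λ x i) (Q (evalVec Λ y j))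

/-- On the cut-off space, `f(x)ᵢ = ⟨E, f⟩` for almost all `x`, with `E` the evaluation vector. -/
theorem ae_eq_inner_evalVec {Λ : ℝ} (f : cutoffSpace Λ) :
    ∀ᵐ x ∂(volume : Measure R3), ∀ i, (f : L2) x i = inner ℂ (evalVec Λ x i) f := by
  obtain ⟨f, hf⟩ := f
  have hsupp := mem_cutoffSpace.1 hf
  have hfin : IsFiniteMeasure ((volume : Measure R3).restrict (freqBall Λ)) :=
    ⟨by
      rw [Measure.restrict_apply_univ]
      exact (isCompact_closedBall (0 : R3) (Λ / (2 * Real.pi))).measure_lt_top⟩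
  have hg : Integrable (⇑(𝓕 f : L2)) (volume : Measure R3) := by
    have h1 : IntegrableOn (⇑(𝓕 f : L2)) (freqBall Λ) (volume : Measure R3) :=
      ((Lp.memLp (𝓕 f : L2)).restrict _).integrable (by norm_num)
    exact h1.integrable_of_ae_notMem_eq_zero hsupp
  have hneg : Continuous fun p : R3 × R3 => (-innerₗ R3) p.1 p.2 := by
    simp only [LinearMap.neg_apply, innerₗ_apply_apply]
    fun_prop
  have hL1 : Continuous (𝓕⁻ (⇑(𝓕 f : L2)) : R3 → Spinor) :=
    VectorFourier.fourierIntegral_continuous Real.continuous_fourierChar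
      (L := -innerₗ R3) hneg hg
  have key : ⇑f =ᵐ[volume] (𝓕⁻ (⇑(𝓕 f : L2)) : R3 → Spinor) := by
    refine ae_eq_of_integral_contDiff_smul_eq
      ((Lp.memLp f).locallyIntegrable (by norm_num)) hL1.locallyIntegrable ?_
    intro φ hφ hφc
    have h1 : HasCompactSupport (Complex.ofRealCLM ∘ φ) := hφc.comp_left rfl
    have h2 : ContDiff ℝ (⊤ : ℕ∞) (Complex.ofRealCLM ∘ φ) := by fun_prop
    set ψ : 𝓢(R3, ℂ) := h1.toSchwartzMap h2 with hψ
    have h3 := congrArg (fun T : 𝓢'(R3, Spinor) => T ψ)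
      (Lp.fourierInv_toTemperedDistribution_eq (𝓕 f : L2))
    rw [FourierTransform.fourierInv_fourier_eq] at h3
    simp only [TemperedDistribution.fourierInv_apply, Lp.toTemperedDistribution_apply] at h3
    have h4 : ∫ x, φ x • (f : R3 → Spinor) x = ∫ x, ψ x • (f : R3 → Spinor) x := by
      simp [hψ]
    have h5 : ∫ x, φ x • (𝓕⁻ (⇑(𝓕 f : L2)) : R3 → Spinor) x =
        ∫ x, ψ x • (𝓕⁻ (⇑(𝓕 f : L2)) : R3 → Spinor) x := by
      simp [hψ]
    rw [h4, h5, ← h3, SchwartzMap.fourierInv_coe]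
    have h6 := VectorFourier.integral_fourierIntegral_smul_eq_flip (L := -innerₗ R3)
      (μ := volume) (ν := volume) Real.continuous_fourierChar hneg
      ψ.integrable hg
    have h7 : (-innerₗ R3).flip = -innerₗ R3 := by
      ext x y
      simp [real_inner_comm]
    rw [h7] at h6
    exact h6
  filter_upwards [key] with x hx i
  rw [hx, Submodule.coe_inner, ← Lp.inner_fourier_eq, evalVec]
  simp only
  rw [FourierTransform.fourier_fourierInv_eq, L2.inner_def, Real.fourierInv_eq']
  have hint : Integrable (fun v : R3 =>
      Complex.exp (((2 * Real.pi * inner ℝ v x : ℝ) : ℂ) * Complex.I) • (𝓕 f : L2) v) := by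
    have hc : Continuous fun v : R3 =>
        Complex.exp (((2 * Real.pi * inner ℝ v x : ℝ) : ℂ) * Complex.I) := by fun_prop
    refine hg.bdd_smul 1 hc.aestronglyMeasurable (.of_forall fun v => ?_)
    rw [Complex.norm_exp_ofReal_mul_I]
  have h8 := (EuclideanSpace.proj i : Spinor →L[ℂ] ℂ).integral_comp_comm hint
  simp only [PiLp.proj_apply] at h8
  rw [← h8]
  refine integral_congr_ae ?_
  filter_upwards [hsupp, (memLp_evalHat Λ x i).coeFn_toLp] with v h9 h10
  rw [h10]
  by_cases hv : v ∈ freqBall Λ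
  · rw [evalHat, Set.indicator_of_mem hv, inner_smul_left, EuclideanSpace.inner_single_left,
      ← Complex.exp_conj]
    simp only [map_mul, map_neg, Complex.ofReal_neg, Complex.conj_ofReal, Complex.conj_I, map_one,
      PiLp.smul_apply, smul_eq_mul, one_mul, real_inner_comm, neg_mul, mul_neg, neg_neg]
  · rw [h9 hv]
    simp

/-- `Q(x, y)` is the integral kernel of `Q`, extended by zero to the orthogonal complement of the
cut-off space. -/
theorem kernel_spec {Λ : ℝ} (Q : cutoffSpace Λ →L[ℂ] cutoffSpace Λ) (f : L2) :
    ∀ᵐ x ∂(volume : Measure R3), ∀ i,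
      (Q ((cutoffSpace Λ).orthogonalProjectionOnto f) : L2) x i =
        ∫ y, ∑ j, kernel Q x y i j * f y j := by
  filter_upwards [ae_eq_inner_evalVec (Q ((cutoffSpace Λ).orthogonalProjectionOnto f))] with x hx i
  rw [hx i, ← ContinuousLinearMap.adjoint_inner_left,
    Submodule.inner_orthogonalProjectionOnto_eq_of_mem_left, L2.inner_def]
  refine integral_congr_ae ?_
  filter_upwards [ae_eq_inner_evalVec (ContinuousLinearMap.adjoint Q (evalVec Λ x i))] with y hy
  rw [PiLp.inner_apply]
  refine Finset.sum_congr rfl fun j _ => ?_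
  rw [RCLike.inner_apply, hy j, ContinuousLinearMap.adjoint_inner_right, inner_conj_symm]
  simp [kernel, mul_comm]

/-- The density `ρ_Q(x) = tr_{ℂ⁴} Q(x, x)`. -/
def density {Λ : ℝ} (Q : cutoffSpace Λ →L[ℂ] cutoffSpace Λ) (x : R3) : ℂ := (kernel Q x x).trace

/-! ## The Coulomb space -/

/-- `h` is a function that is the Fourier transform, in the sense of tempered distributions, of the
tempered distribution given by the function `f`. -/
def IsFourierOf (f h : R3 → ℂ) : Prop :=
  ∀ φ : 𝓢(R3, ℂ), Integrable (fun x => f x * φ x) ∧ Integrable (fun ξ => h ξ * φ ξ) ∧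
    ∫ x, f x * (𝓕 φ : 𝓢(R3, ℂ)) x = ∫ ξ, h ξ * φ ξ

theorem IsFourierOf.locallyIntegrable {f h : R3 → ℂ} (H : IsFourierOf f h) :
    LocallyIntegrable h volume := by
  intro x
  let b : ContDiffBump x := ⟨1, 2, one_pos, one_lt_two⟩
  have h1 : HasCompactSupport (Complex.ofRealCLM ∘ b) := b.hasCompactSupport.comp_left rfl
  have h2 : ContDiff ℝ (⊤ : ℕ∞) (Complex.ofRealCLM ∘ b) :=
    Complex.ofRealCLM.contDiff.comp b.contDiff
  have h3 := (H (h1.toSchwartzMap h2)).2.1.integrableOn (s := Metric.closedBall x 1)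
  refine ⟨Metric.closedBall x 1, Metric.closedBall_mem_nhds x one_pos, h3.congr_fun ?_
    Metric.isClosed_closedBall.measurableSet⟩
  intro y hy
  simp [b.one_of_mem_closedBall hy]

/-- The distributional Fourier transform is unique almost everywhere. -/
theorem IsFourierOf.ae_eq {f h h' : R3 → ℂ} (H : IsFourierOf f h) (H' : IsFourierOf f h') :
    h =ᵐ[volume] h' := by
  refine ae_eq_of_integral_contDiff_smul_eq H.locallyIntegrable H'.locallyIntegrable ?_
  intro φ hφ hφc
  have h1 : HasCompactSupport (Complex.ofRealCLM ∘ φ) := hφc.comp_left rfl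
  have h2 : ContDiff ℝ (⊤ : ℕ∞) (Complex.ofRealCLM ∘ φ) := by fun_prop
  have h3 := (H (h1.toSchwartzMap h2)).2.2.symm.trans (H' (h1.toSchwartzMap h2)).2.2
  simpa [mul_comm] using h3

open Classical in
/-- The distributional Fourier transform of `f`, when it is a function. -/
def hat (f : R3 → ℂ) : R3 → ℂ := if h : ∃ g, IsFourierOf f g then h.choose else 0

/-- The Coulomb space `𝒞`: the Fourier transform is a function with `∫ |f̂(ξ)|² / |ξ|² dξ < ∞`. -/
def IsCoulomb (f : R3 → ℂ) : Prop :=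
  ∃ h, IsFourierOf f h ∧ Integrable fun ξ => ‖h ξ‖ ^ 2 / ‖ξ‖ ^ 2

/-- The Coulomb inner product `D(f, g) = ∬ f(x) conj(g(y)) / |x-y| dx dy`, written in Fourier
space: `(1/π) ∫ f̂(ξ) conj(ĝ(ξ)) / |ξ|² dξ` in Mathlib's normalisation of the Fourier transform,
that is, `4π ∫ f̂(k) conj(ĝ(k)) / |k|² dk` for the unitary one with `e^{-ik·x}`. -/
def coulomb (f g : R3 → ℂ) : ℂ :=
  (1 / Real.pi : ℂ) * ∫ ξ : R3, hat f ξ * (starRingEnd ℂ) (hat g ξ) / (‖ξ‖ ^ 2 : ℝ)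

/-! ## The energy -/

/-- The reduced Bogoliubov–Dirac–Fock energy
`tr₀(D⁰ Q) - α D(ρ_Q, ν) + (α/2) D(ρ_Q, ρ_Q)` (real for `Q` in the variational set). -/
def energy (α Λ : ℝ) (ν : R3 → ℝ) (Q : cutoffSpace Λ →L[ℂ] cutoffSpace Λ) : ℝ :=
  (genTrace (dirac Λ * Q) - α * coulomb (density Q) (fun x => (ν x : ℂ)) +
    α / 2 * coulomb (density Q) (density Q)).re

/-- The ground-state energy `E(Z) = inf_{Q ∈ 𝒦} ℰ^{Zν}(Q)`, an infimum in `[-∞, ∞]`. -/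
def groundEnergy (α Λ : ℝ) (ν : R3 → ℝ) (Z : ℝ) : EReal :=
  ⨅ Q ∈ variationalSet Λ, ((energy α Λ (fun x => Z * ν x) Q : ℝ) : EReal)

/-- The constant `c₁ = 2^{-23/3} 3^{1/3} π^{-4/3}`. -/
def c₁ : ℝ := (2 : ℝ) ^ (-23 / 3 : ℝ) * (3 : ℝ) ^ (1 / 3 : ℝ) * Real.pi ^ (-4 / 3 : ℝ)

end RBDF

end

noncomputable section

open MeasureTheory FourierTransform Matrix
open scoped SchwartzMap ENNReal

namespace RBDF

/-! ## Fourier multipliers on the cut-off space -/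

/-! The bound is variational. Let `P` be the free spectral projection on the side favoured by the
sign of `q` (positive for `q > 0`, negative for `q < 0`), and let `g(x) = exp(-π|x|²/R²)`. The trial
state is `P g P` in the first case and `-P g P` in the second. Since `0 ≤ g ≤ 1`, `0 ≤ P g P ≤ P`,
which gives the operator constraints; since `g` is integrable and the cut-off makes evaluation at a
point bounded, uniformly in the point, the trace-ideal conditions follow from Bessel's inequality.

`P` commutes with translations, so the density of `P g P` is `g * k`, where `k ≥ 0` is the squared
norm of the convolution kernel of `P`. As `P(p)` has rank two, `∫ k = w = Λ³/(3π²)`, and the total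
charge of `P g P` is `w R³`.

Three estimates carry the proof. The kinetic energy is at most `C R³` because `D⁰` is bounded under
the cut-off (`exists_norm_genTrace_mul_trialOp_le`). The self-energy `D(ρ, ρ)` is at most `√2 w² R⁵`
(`norm_coulomb_density_self_le`). For large `R` the Fourier transform of `g` concentrates at the
origin, where those of `k` and `ν` equal `w` and `q`; hence `D(ρ, ν)` is `2 w q R²`, up to half of
that and a term linear in `R` (`norm_coulomb_density_sub_le`).

With `R³ = |q| Z / (2w)` both Coulomb terms are of order `Z^{5/3}` and attraction wins, while the
kinetic term is of order `Z` and the linear correction of order `Z^{4/3}`. Both are absorbed for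
large `Z` (`exists_scale`). The constants come from `Λ` and `P` alone, so the threshold sees `ν`
only through `|q|` and the first moment. -/

theorem cutoffSpace_ext {Λ : ℝ} {f g : cutoffSpace Λ}
    (h : (𝓕 (f : L2) : L2) =ᵐ[volume] (𝓕 (g : L2) : L2)) : f = g := by
  have h1 : (𝓕 (f : L2) : L2) = 𝓕 (g : L2) := Lp.ext h
  exact Subtype.ext ((Lp.fourierTransformₗᵢ R3 Spinor).injective h1)

theorem fourier_multiplier {Λ : ℝ} (m : C(R3, Matrix (Fin 4) (Fin 4) ℂ)) (f : cutoffSpace Λ) :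
    (𝓕 (multiplier Λ m f : L2) : L2) =ᵐ[volume]
      fun ξ => cutSymbol Λ m ξ ((𝓕 (f : L2) : L2) ξ) :=
  fourier_multiplierL2 Λ m f

theorem multiplier_one (Λ : ℝ) : multiplier Λ 1 = 1 := by
  ext1 f
  refine cutoffSpace_ext ?_
  filter_upwards [fourier_multiplier 1 f, mem_cutoffSpace.1 f.2] with ξ h1 h2
  rw [h1, one_apply_eq_self]
  by_cases hξ : ξ ∈ freqBall Λ
  · simp [cutSymbol, hξ]
  · simp [h2 hξ]

theorem multiplier_sub (Λ : ℝ) (m m' : C(R3, Matrix (Fin 4) (Fin 4) ℂ)) :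
    multiplier Λ (m - m') = multiplier Λ m - multiplier Λ m' := by
  ext1 f
  refine cutoffSpace_ext ?_
  have h0 : (𝓕 ((multiplier Λ m - multiplier Λ m') f : L2) : L2) =
      𝓕 (multiplier Λ m f : L2) - 𝓕 (multiplier Λ m' f : L2) := by
    exact (Lp.fourierTransformₗᵢ R3 Spinor).map_sub _ _
  rw [h0]
  filter_upwards [fourier_multiplier m f, fourier_multiplier m' f, fourier_multiplier (m - m') f,
    Lp.coeFn_sub (𝓕 (multiplier Λ m f : L2) : L2) (𝓕 (multiplier Λ m' f : L2))] with ξ h1 h2 h3 h4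
  rw [h3, h4, Pi.sub_apply, h1, h2]
  by_cases hξ : ξ ∈ freqBall Λ
  · simp [cutSymbol, hξ]
  · simp [cutSymbol, hξ]

theorem multiplier_mul (Λ : ℝ) (m m' : C(R3, Matrix (Fin 4) (Fin 4) ℂ)) :
    multiplier Λ (m * m') = multiplier Λ m * multiplier Λ m' := by
  ext1 f
  refine cutoffSpace_ext ?_
  filter_upwards [fourier_multiplier m (multiplier Λ m' f), fourier_multiplier m' f,
    fourier_multiplier (m * m') f] with ξ h1 h2 h3
  change _ = (𝓕 (multiplier Λ m (multiplier Λ m' f) : L2) : L2) ξ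
  rw [h3, h1, h2]
  by_cases hξ : ξ ∈ freqBall Λ
  · simp [cutSymbol, hξ]
  · simp [cutSymbol, hξ]

theorem inner_multiplier {Λ : ℝ} (m : C(R3, Matrix (Fin 4) (Fin 4) ℂ)) (f g : cutoffSpace Λ) :
    inner ℂ f (multiplier Λ m g) =
      ∫ ξ, inner ℂ ((𝓕 (f : L2) : L2) ξ) (cutSymbol Λ m ξ ((𝓕 (g : L2) : L2) ξ)) := by
  rw [Submodule.coe_inner, ← Lp.inner_fourier_eq, L2.inner_def]
  refine integral_congr_ae ?_
  filter_upwards [fourier_multiplier m g] with ξ h1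
  rw [h1]

theorem multiplier_isSelfAdjoint (Λ : ℝ) {m : C(R3, Matrix (Fin 4) (Fin 4) ℂ)}
    (hm : ∀ p, (m p).IsHermitian) : IsSelfAdjoint (multiplier Λ m) := by
  rw [ContinuousLinearMap.isSelfAdjoint_iff_isSymmetric]
  intro f g
  simp only [ContinuousLinearMap.coe_coe]
  rw [inner_multiplier, ← inner_conj_symm, inner_multiplier, ← integral_conj]
  refine integral_congr_ae (.of_forall fun ξ => ?_)
  simp only [inner_conj_symm]
  by_cases hξ : ξ ∈ freqBall Λ
  · simp only [cutSymbol, Set.indicator_of_mem hξ]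
    have h1 : IsSelfAdjoint (toEuclideanCLM (n := Fin 4) (𝕜 := ℂ) (m ((2 * Real.pi) • ξ))) := by
      rw [IsSelfAdjoint, ← map_star, star_eq_conjTranspose, (hm _).eq]
    exact (ContinuousLinearMap.isSelfAdjoint_iff_isSymmetric.1 h1) _ _
  · simp [cutSymbol, hξ]

/-! ## Evaluation vectors -/

theorem fourier_evalVec (Λ : ℝ) (x : R3) (i : Fin 4) :
    (𝓕 (evalVec Λ x i : L2) : L2) =ᵐ[volume] evalHat Λ x i := by
  rw [evalVec, FourierTransform.fourier_fourierInv_eq]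
  exact (memLp_evalHat Λ x i).coeFn_toLp

/-- The convolution kernel of the Fourier multiplier with symbol `m`. -/
def convKernel (Λ : ℝ) (m : C(R3, Matrix (Fin 4) (Fin 4) ℂ)) (i j : Fin 4) (x : R3) : ℂ :=
  ∫ ξ in freqBall Λ,
    Complex.exp ((2 * Real.pi * inner ℝ x ξ : ℝ) * Complex.I) * m ((2 * Real.pi) • ξ) i j

/-- The phases of the two evaluation vectors combine into one depending on `x - y` only. This
translation invariance is what later turns the trial density into a convolution. -/
theorem inner_evalVec_multiplier (Λ : ℝ) (m : C(R3, Matrix (Fin 4) (Fin 4) ℂ)) (x y : R3)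
    (i j : Fin 4) :
    inner ℂ (evalVec Λ x i) (multiplier Λ m (evalVec Λ y j)) = convKernel Λ m i j (x - y) := by
  rw [inner_multiplier, convKernel, ← integral_indicator (measurableSet_freqBall Λ)]
  refine integral_congr_ae ?_
  filter_upwards [fourier_evalVec Λ x i, fourier_evalVec Λ y j] with ξ h1 h2
  rw [h1, h2]
  by_cases hξ : ξ ∈ freqBall Λ
  · simp only [cutSymbol, evalHat, Set.indicator_of_mem hξ, inner_smul_left, map_smul,
      inner_smul_right, EuclideanSpace.inner_single_left, map_one, one_mul, ← Complex.exp_conj,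
      map_mul, Complex.conj_ofReal, Complex.conj_I, inner_sub_left]
    rw [mul_sub, ← mul_assoc, ← Complex.exp_add]
    congr 1
    · congr 1
      push_cast
      ring
    · rw [ofLp_toEuclideanCLM]
      simp
  · simp [cutSymbol, hξ]

theorem norm_evalVec_sq (Λ : ℝ) (x : R3) (i : Fin 4) :
    ‖evalVec Λ x i‖ ^ 2 = volume.real (freqBall Λ) := by
  have h := inner_evalVec_multiplier Λ 1 x x i i
  rw [multiplier_one, one_apply_eq_self] at h
  replace h := (inner_self_eq_norm_sq_to_K (𝕜 := ℂ) (evalVec Λ x i)).symm.trans h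
  have h2 : convKernel Λ 1 i i (x - x) = (volume.real (freqBall Λ) : ℂ) := by
    simp [convKernel, Measure.real]
  rw [h2] at h
  refine Complex.ofReal_injective ?_
  rw [Complex.ofReal_pow]
  exact h

/-! ### Positive operators `S* S` and trace ideals -/

theorem conj_neg {R : Type*} [Ring R] (a q : R) : a * -q * a = -(a * q * a) := by
  rw [mul_neg, neg_mul]

theorem conj_mul_neg {R : Type*} [Ring R] (a b q : R) :
    a * (b * -q) * a = -(a * (b * q) * a) := by
  rw [mul_neg, conj_neg]

section Gram

variable {H K : Type*} [NormedAddCommGroup H] [InnerProductSpace ℂ H] [CompleteSpace H]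
  [NormedAddCommGroup K] [InnerProductSpace ℂ K] [CompleteSpace K]

/-- The operator `S* S`. -/
def gram (S : H →L[ℂ] K) : H →L[ℂ] H := (ContinuousLinearMap.adjoint S).comp S

theorem inner_gram (S : H →L[ℂ] K) (f g : H) : inner ℂ f (gram S g) = inner ℂ (S f) (S g) := by
  rw [gram, ContinuousLinearMap.comp_apply, ContinuousLinearMap.adjoint_inner_right]

theorem gram_nonneg (S : H →L[ℂ] K) : 0 ≤ gram S :=
  (ContinuousLinearMap.nonneg_iff_isPositive _).2 (ContinuousLinearMap.isPositive_adjoint_comp_self S)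

theorem gram_isSelfAdjoint (S : H →L[ℂ] K) : IsSelfAdjoint (gram S) :=
  (ContinuousLinearMap.isPositive_adjoint_comp_self S).isSelfAdjoint

theorem neg_gram_isSelfAdjoint (S : H →L[ℂ] K) : IsSelfAdjoint (-gram S) :=
  (gram_isSelfAdjoint S).neg

/-- For an orthogonal projection, `‖S P f‖² ≤ ‖P f‖² = ⟨P f, f⟩`. This supplies the Pauli constraint
for the trial operator. -/
theorem gram_comp_le {P : H →L[ℂ] H} (hP : IsSelfAdjoint P) (hP2 : P * P = P) {S : H →L[ℂ] K}
    (hS : ∀ f, ‖S f‖ ≤ ‖f‖) : gram (S.comp P) ≤ P := by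
  rw [ContinuousLinearMap.le_def, ContinuousLinearMap.isPositive_def']
  refine ⟨hP.sub (gram_isSelfAdjoint _), fun f => ?_⟩
  have h2 : inner ℂ (P f) f = inner ℂ (P f) (P f) := by
    rw [← ContinuousLinearMap.adjoint_inner_left, ContinuousLinearMap.isSelfAdjoint_iff'.1 hP]
    exact congrArg (fun T : H →L[ℂ] H => inner ℂ (T f) f) hP2.symm
  rw [ContinuousLinearMap.reApplyInnerSelf_apply, _root_.sub_apply, inner_sub_left, h2,
    ← inner_conj_symm _ f, inner_gram, inner_conj_symm, map_sub,
    inner_self_eq_norm_sq (𝕜 := ℂ), inner_self_eq_norm_sq (𝕜 := ℂ), sub_nonneg]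
  gcongr
  exact hS _

theorem isHilbertSchmidt_gram {S : H →L[ℂ] K} (hS : Summable fun n => ‖S (basis H n)‖ ^ 2) :
    IsHilbertSchmidt (gram S) := by
  refine (hS.mul_left (‖ContinuousLinearMap.adjoint S‖ ^ 2)).of_nonneg_of_le
    (fun _ => sq_nonneg _) fun n => ?_
  rw [← mul_pow]
  gcongr
  exact (ContinuousLinearMap.adjoint S).le_opNorm _

/-- `T S* S T` is nonnegative, hence its own absolute value, and its trace is the squared
Hilbert–Schmidt norm of `S T`. -/
theorem isTraceClass_gram_conj {S : H →L[ℂ] K} {T : H →L[ℂ] H} (hT : IsSelfAdjoint T)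
    (hS : Summable fun n => ‖S (T (basis H n))‖ ^ 2) : IsTraceClass (T * gram S * T) := by
  have h1 : CFC.abs (T * gram S * T) = T * gram S * T :=
    CFC.abs_of_nonneg _ (hT.conjugate_nonneg (gram_nonneg S))
  rw [IsTraceClass, h1]
  refine hS.congr fun n => ?_
  have h2 : inner ℂ (basis H n) ((T * gram S * T) (basis H n)) =
      inner ℂ (T (basis H n)) (gram S (T (basis H n))) := by
    rw [← ContinuousLinearMap.adjoint_inner_right, ContinuousLinearMap.isSelfAdjoint_iff'.1 hT]
    rfl
  rw [h2, inner_gram]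
  exact (inner_self_eq_norm_sq (𝕜 := ℂ) _).symm

theorem IsTraceClass.neg {A : H →L[ℂ] H} (hA : IsTraceClass A) : IsTraceClass (-A) := by
  rwa [IsTraceClass, CFC.abs_neg]

theorem IsTraceClass.conj_neg {A Q : H →L[ℂ] H} (h : IsTraceClass (A * Q * A)) :
    IsTraceClass (A * -Q * A) := by
  rw [RBDF.conj_neg]
  exact h.neg

theorem IsHilbertSchmidt.neg {A : H →L[ℂ] H} (hA : IsHilbertSchmidt A) :
    IsHilbertSchmidt (-A) := by
  refine Summable.congr hA fun n => ?_
  rw [_root_.neg_apply, norm_neg]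

theorem trace_neg (A : H →L[ℂ] H) : trace (-A) = -trace A := by
  simp [trace, tsum_neg]

/-- The diagonal entry is `⟨S A* f, S B f⟩`; Cauchy–Schwarz and `uv ≤ u² + v²` separate the factors.
Traces of products are thus bounded by Hilbert–Schmidt sums, without cyclicity of the trace. -/
theorem norm_inner_gram_conj_le (S : H →L[ℂ] K) (A B : H →L[ℂ] H) (f : H) :
    ‖inner ℂ f ((A * gram S * B) f)‖ ≤
      ‖S (ContinuousLinearMap.adjoint A f)‖ ^ 2 + ‖S (B f)‖ ^ 2 := by
  have h1 : inner ℂ f ((A * gram S * B) f) =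
      inner ℂ (ContinuousLinearMap.adjoint A f) (gram S (B f)) :=
    (ContinuousLinearMap.adjoint_inner_left A _ _).symm
  rw [h1, inner_gram]
  refine (norm_inner_le_norm _ _).trans ?_
  nlinarith [sq_nonneg (‖S (ContinuousLinearMap.adjoint A f)‖ - ‖S (B f)‖),
    sq_nonneg ‖S (ContinuousLinearMap.adjoint A f)‖, sq_nonneg ‖S (B f)‖]

theorem norm_trace_le_of_forall {A : H →L[ℂ] H} {b : basisIndex H → ℝ} {C : ℝ} (hb : 0 ≤ b)
    (hA : ∀ n, ‖inner ℂ (basis H n) (A (basis H n))‖ ≤ b n)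
    (hC : ∀ F : Finset (basisIndex H), ∑ n ∈ F, b n ≤ C) : ‖trace A‖ ≤ C := by
  have hs : Summable b := summable_of_sum_le hb hC
  exact (tsum_of_norm_bounded hs.hasSum hA).trans (Real.tsum_le_of_sum_le hb hC)

end Gram

/-! ## Localisation in position space -/

/-- Multiplication by a bounded function, from the cut-off space to `L²`. -/
def localize (Λ : ℝ) {h : R3 → ℂ} (hh : MemLp h ∞ (volume : Measure R3)) :
    cutoffSpace Λ →L[ℂ] L2 :=
  ((ContinuousLinearMap.lsmul ℂ ℂ).holderL volume ∞ 2 2 hh.toLp).comp (cutoffSpace Λ).subtypeL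

theorem coeFn_localize {Λ : ℝ} {h : R3 → ℂ} (hh : MemLp h ∞ (volume : Measure R3))
    (f : cutoffSpace Λ) : localize Λ hh f =ᵐ[volume] fun x => h x • (f : L2) x := by
  have h0 : localize Λ hh f = (ContinuousLinearMap.lsmul ℂ ℂ).holder 2 hh.toLp (f : L2) := rfl
  rw [h0]
  filter_upwards [ContinuousLinearMap.coeFn_holder (r := 2)
    (ContinuousLinearMap.lsmul ℂ ℂ) hh.toLp (f : L2), hh.coeFn_toLp] with x h1 h2
  rw [h1, h2]
  rfl

theorem norm_sq_L2 (f : L2) : ‖f‖ ^ 2 = ∫ x, ‖f x‖ ^ 2 := by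
  have h1 := (inner_self_eq_norm_sq_to_K (𝕜 := ℂ) f).symm.trans (L2.inner_def f f)
  simp only [inner_self_eq_norm_sq_to_K] at h1
  have h2 : ∫ x, ((‖f x‖ : ℂ)) ^ 2 = ((∫ x, ‖f x‖ ^ 2 : ℝ) : ℂ) := by
    rw [← integral_complex_ofReal]
    push_cast
    rfl
  refine Complex.ofReal_injective ?_
  rw [Complex.ofReal_pow]
  exact h1.trans h2

theorem integrable_norm_sq_L2 (f : L2) : Integrable fun x => ‖f x‖ ^ 2 :=
  (Lp.memLp f).integrable_norm_pow (by norm_num)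

theorem norm_sq_localize_ae {Λ : ℝ} {h : R3 → ℂ} (hh : MemLp h ∞ (volume : Measure R3))
    (f : cutoffSpace Λ) : (fun x => ‖localize Λ hh f x‖ ^ 2) =ᵐ[volume]
      fun x => ‖h x‖ ^ 2 * ∑ i, ‖inner ℂ (evalVec Λ x i) f‖ ^ 2 := by
  filter_upwards [coeFn_localize hh f, ae_eq_inner_evalVec f] with x h1 h2
  rw [h1, norm_smul, mul_pow, EuclideanSpace.norm_sq_eq]
  simp only [h2]

theorem norm_sq_localize {Λ : ℝ} {h : R3 → ℂ} (hh : MemLp h ∞ (volume : Measure R3))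
    (f : cutoffSpace Λ) : ‖localize Λ hh f‖ ^ 2 =
      ∫ x, ‖h x‖ ^ 2 * ∑ i, ‖inner ℂ (evalVec Λ x i) f‖ ^ 2 := by
  rw [norm_sq_L2]
  exact integral_congr_ae (norm_sq_localize_ae hh f)

theorem integrable_localize {Λ : ℝ} {h : R3 → ℂ} (hh : MemLp h ∞ (volume : Measure R3))
    (f : cutoffSpace Λ) :
    Integrable fun x => ‖h x‖ ^ 2 * ∑ i, ‖inner ℂ (evalVec Λ x i) f‖ ^ 2 :=
  (integrable_norm_sq_L2 _).congr (norm_sq_localize_ae hh f)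

theorem norm_localize_le {Λ : ℝ} {h : R3 → ℂ} (hh : MemLp h ∞ (volume : Measure R3))
    (h1 : ∀ x, ‖h x‖ ≤ 1) (f : cutoffSpace Λ) : ‖localize Λ hh f‖ ≤ ‖f‖ := by
  refine Lp.norm_le_norm_of_ae_le (f := localize Λ hh f) (g := (f : L2)) ?_
  filter_upwards [coeFn_localize hh f] with x hx
  rw [hx, norm_smul]
  exact mul_le_of_le_one_left (norm_nonneg _) (h1 x)

/-- The Hilbert–Schmidt bound for `h T`, by Bessel's inequality. -/
theorem sum_norm_sq_localize_le {Λ : ℝ} {h : R3 → ℂ} (hh : MemLp h ∞ (volume : Measure R3))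
    (hi : Integrable fun x => ‖h x‖ ^ 2) (T : cutoffSpace Λ →L[ℂ] cutoffSpace Λ)
    (F : Finset (basisIndex (cutoffSpace Λ))) :
    ∑ n ∈ F, ‖localize Λ hh (T (basis _ n))‖ ^ 2 ≤
      4 * volume.real (freqBall Λ) * ‖T‖ ^ 2 * ∫ x, ‖h x‖ ^ 2 := by
  simp only [norm_sq_localize]
  rw [← integral_finsetSum _ fun n _ => integrable_localize hh _, ← integral_const_mul]
  refine integral_mono (integrable_finsetSum _ fun n _ => integrable_localize hh _)
    (hi.const_mul _) fun x => ?_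
  simp only
  rw [← Finset.mul_sum, Finset.sum_comm, mul_comm]
  refine mul_le_mul_of_nonneg_right ?_ (by positivity)
  -- Moving `T` to the evaluation vector, Bessel bounds the sum by `‖T* E‖²`, and `‖E‖²` is the
  -- volume of the frequency ball whatever the point `x`. The outer factor 4 counts spinor
  -- components.
  have h1 : ∀ i : Fin 4, ∑ n ∈ F, ‖inner ℂ (evalVec Λ x i) (T (basis _ n))‖ ^ 2 ≤
      ‖T‖ ^ 2 * volume.real (freqBall Λ) := by
    intro i
    have h2 := (basis (cutoffSpace Λ)).orthonormal.sum_inner_products_le (s := F)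
      (ContinuousLinearMap.adjoint T (evalVec Λ x i))
    refine le_trans (le_of_eq (Finset.sum_congr rfl fun n _ => ?_)) (h2.trans ?_)
    · rw [← ContinuousLinearMap.adjoint_inner_left, norm_inner_symm]
    · rw [← norm_evalVec_sq Λ x i, ← mul_pow]
      gcongr
      refine (ContinuousLinearMap.le_opNorm _ _).trans_eq ?_
      rw [LinearIsometryEquiv.norm_map]
  calc _ ≤ ∑ i : Fin 4, ‖T‖ ^ 2 * volume.real (freqBall Λ) := Finset.sum_le_sum fun i _ => h1 i
    _ = _ := by simp; ring

theorem summable_norm_sq_localize {Λ : ℝ} {h : R3 → ℂ} (hh : MemLp h ∞ (volume : Measure R3))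
    (hi : Integrable fun x => ‖h x‖ ^ 2) (T : cutoffSpace Λ →L[ℂ] cutoffSpace Λ) :
    Summable fun n => ‖localize Λ hh (T (basis _ n))‖ ^ 2 :=
  summable_of_sum_le (fun _ => sq_nonneg _) (sum_norm_sq_localize_le hh hi T)

/-! ## The trial operator -/

/-- The operator `P |h|² P` for a Fourier multiplier `P`. -/
def trialOp (Λ : ℝ) (m : C(R3, Matrix (Fin 4) (Fin 4) ℂ)) {h : R3 → ℂ}
    (hh : MemLp h ∞ (volume : Measure R3)) : cutoffSpace Λ →L[ℂ] cutoffSpace Λ :=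
  gram ((localize Λ hh).comp (multiplier Λ m))

section trialOp

variable {Λ : ℝ} {m : C(R3, Matrix (Fin 4) (Fin 4) ℂ)} {h : R3 → ℂ}
  (hh : MemLp h ∞ (volume : Measure R3))

theorem trialOp_le (hm : ∀ p, (m p).IsHermitian) (hm2 : m * m = m) (h1 : ∀ x, ‖h x‖ ≤ 1) :
    trialOp Λ m hh ≤ multiplier Λ m :=
  gram_comp_le (multiplier_isSelfAdjoint Λ hm) (by rw [← multiplier_mul, hm2])
    (norm_localize_le hh h1)

theorem isHilbertSchmidt_trialOp (hi : Integrable fun x => ‖h x‖ ^ 2) :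
    IsHilbertSchmidt (trialOp Λ m hh) :=
  isHilbertSchmidt_gram (summable_norm_sq_localize hh hi (multiplier Λ m))

theorem isTraceClass_conj_trialOp (hi : Integrable fun x => ‖h x‖ ^ 2)
    {T : cutoffSpace Λ →L[ℂ] cutoffSpace Λ} (hT : IsSelfAdjoint T) :
    IsTraceClass (T * trialOp Λ m hh * T) :=
  isTraceClass_gram_conj hT (summable_norm_sq_localize hh hi (multiplier Λ m * T))

theorem blockPP_add_blockNN_mul (A B : cutoffSpace Λ →L[ℂ] cutoffSpace Λ) :
    blockPP (A * B) + blockNN (A * B) = Ppos Λ * A * B * Ppos Λ + Pneg Λ * A * B * Pneg Λ := by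
  simp only [blockPP, blockNN, mul_assoc]

/-- The kinetic energy of the trial operator is at most a multiple of `∫ |h|²`. -/
theorem exists_norm_genTrace_mul_trialOp_le (Λ : ℝ) (m : C(R3, Matrix (Fin 4) (Fin 4) ℂ)) :
    ∃ C, 0 ≤ C ∧ ∀ {h : R3 → ℂ} (hh : MemLp h ∞ (volume : Measure R3)),
      Integrable (fun x => ‖h x‖ ^ 2) →
      ‖genTrace (dirac Λ * trialOp Λ m hh)‖ ≤ C * ∫ x, ‖h x‖ ^ 2 := by
  let P := multiplier Λ m
  -- With `S` the localisation, the positive block contributes `⟨S P (P₊ D)* e, S P P₊ e⟩` on the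
  -- diagonal, and the negative block likewise with `P₋`. These four operators are what acts on the
  -- basis vectors before `S`.
  let A₁ := P * ContinuousLinearMap.adjoint (Ppos Λ * dirac Λ)
  let B₁ := P * Ppos Λ
  let A₂ := P * ContinuousLinearMap.adjoint (Pneg Λ * dirac Λ)
  let B₂ := P * Pneg Λ
  refine ⟨4 * volume.real (freqBall Λ) * (‖A₁‖ ^ 2 + ‖B₁‖ ^ 2 + ‖A₂‖ ^ 2 + ‖B₂‖ ^ 2),
    by positivity, fun {h} hh hi => ?_⟩
  refine norm_trace_le_of_forall (b := fun n =>
    (‖localize Λ hh (A₁ (basis _ n))‖ ^ 2 + ‖localize Λ hh (B₁ (basis _ n))‖ ^ 2) +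
    (‖localize Λ hh (A₂ (basis _ n))‖ ^ 2 + ‖localize Λ hh (B₂ (basis _ n))‖ ^ 2))
    (fun n => by positivity) (fun n => ?_) fun F => ?_
  · rw [blockPP_add_blockNN_mul, _root_.add_apply, inner_add_right]
    exact (norm_add_le _ _).trans (add_le_add (norm_inner_gram_conj_le _ _ _ _)
      (norm_inner_gram_conj_le _ _ _ _))
  · simp only [Finset.sum_add_distrib]
    have h3 := fun T => sum_norm_sq_localize_le hh hi T F
    linarith [h3 A₁, h3 B₁, h3 A₂, h3 B₂]

end trialOp

/-! ## The density of the trial operator -/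

/-- The squared Hilbert–Schmidt norm of the convolution kernel of a Fourier multiplier. -/
def kernelDensity (Λ : ℝ) (m : C(R3, Matrix (Fin 4) (Fin 4) ℂ)) (x : R3) : ℝ :=
  ∑ j, ∑ i, ‖convKernel Λ m i j x‖ ^ 2

theorem kernelDensity_nonneg (Λ : ℝ) (m : C(R3, Matrix (Fin 4) (Fin 4) ℂ)) (x : R3) :
    0 ≤ kernelDensity Λ m x := by
  unfold kernelDensity
  positivity

section

variable {Λ : ℝ} {m : C(R3, Matrix (Fin 4) (Fin 4) ℂ)}

/-- The columns of the convolution kernel are the images under the multiplier of the evaluation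
vectors at the origin. They lie in `L²`, whence the integrability of the kernel density. -/
theorem kernelDensity_ae_eq : kernelDensity Λ m =ᵐ[volume]
    fun x => ∑ j, ‖(multiplier Λ m (evalVec Λ 0 j) : L2) x‖ ^ 2 := by
  have h1 : ∀ᵐ x ∂(volume : Measure R3), ∀ j i, (multiplier Λ m (evalVec Λ 0 j) : L2) x i =
      inner ℂ (evalVec Λ x i) (multiplier Λ m (evalVec Λ 0 j)) :=
    ae_all_iff.2 fun j => ae_eq_inner_evalVec _
  filter_upwards [h1] with x hx
  refine Finset.sum_congr rfl fun j _ => ?_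
  rw [EuclideanSpace.norm_sq_eq]
  refine Finset.sum_congr rfl fun i _ => ?_
  rw [hx j i, inner_evalVec_multiplier, sub_zero]

theorem integrable_kernelDensity : Integrable (kernelDensity Λ m) :=
  (integrable_finsetSum _ fun _ _ => integrable_norm_sq_L2 _).congr kernelDensity_ae_eq.symm

theorem inner_multiplier_self (hm : ∀ p, (m p).IsHermitian) (hm2 : m * m = m)
    (f : cutoffSpace Λ) : ((‖multiplier Λ m f‖ ^ 2 : ℝ) : ℂ) = inner ℂ f (multiplier Λ m f) := by
  have h1 := multiplier_mul Λ m m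
  rw [hm2] at h1
  conv_rhs => rw [h1]
  change _ = inner ℂ f (multiplier Λ m (multiplier Λ m f))
  rw [← ContinuousLinearMap.adjoint_inner_left,
    ContinuousLinearMap.isSelfAdjoint_iff'.1 (multiplier_isSelfAdjoint Λ hm)]
  rw [Complex.ofReal_pow]
  exact (inner_self_eq_norm_sq_to_K (𝕜 := ℂ) _).symm

/-- Since the multiplier `P` is an orthogonal projection, `∑ ‖P Eⱼ‖² = ∑ ⟨Eⱼ, P Eⱼ⟩`, which is the
integral of the matrix trace of the symbol over the frequency ball. -/
theorem integral_kernelDensity (hm : ∀ p, (m p).IsHermitian) (hm2 : m * m = m)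
    (htr : ∀ p, (m p).trace = 2) :
    ∫ x, kernelDensity Λ m x = 2 * volume.real (freqBall Λ) := by
  rw [integral_congr_ae kernelDensity_ae_eq, integral_finsetSum _ fun _ _ => integrable_norm_sq_L2 _]
  simp only [← norm_sq_L2]
  refine Complex.ofReal_injective ?_
  have h1 : ∀ j, Continuous fun ξ : R3 => m ((2 * Real.pi) • ξ) j j := fun j =>
    (m.continuous.comp (continuous_const_smul _)).matrix_elem j j
  have h2 : ∀ j, IntegrableOn (fun ξ : R3 => m ((2 * Real.pi) • ξ) j j) (freqBall Λ) := fun j =>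
    (h1 j).continuousOn.integrableOn_compact (isCompact_closedBall _ _)
  rw [Complex.ofReal_sum]
  calc _ = ∑ j, convKernel Λ m j j 0 := by
        refine Finset.sum_congr rfl fun j _ => ?_
        rw [← sub_self (0 : R3), ← inner_evalVec_multiplier, ← inner_multiplier_self hm hm2]
        simp
    _ = ∑ j, ∫ ξ in freqBall Λ, m ((2 * Real.pi) • ξ) j j := by simp [convKernel]
    _ = ∫ ξ in freqBall Λ, (m ((2 * Real.pi) • ξ)).trace := by
        rw [← integral_finsetSum _ fun j _ => h2 j]
        rfl
    _ = _ := by simp [htr, Measure.real, mul_comm]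

/-- A diagonal kernel entry is `‖h P E‖²` with `E` the evaluation vector at `x`; writing this norm
as an integral over `z` produces the kernel at `x - z`. -/
theorem density_trialOp (hm : ∀ p, (m p).IsHermitian) {h : R3 → ℂ}
    (hh : MemLp h ∞ (volume : Measure R3)) (x : R3) :
    density (trialOp Λ m hh) x = ((∫ z, ‖h z‖ ^ 2 * kernelDensity Λ m (x - z) : ℝ) : ℂ) := by
  have h1 : ∀ i z j, ‖inner ℂ (evalVec Λ z j) (multiplier Λ m (evalVec Λ x i))‖ =
      ‖convKernel Λ m i j (x - z)‖ := by
    intro i z j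
    rw [← inner_evalVec_multiplier, ← ContinuousLinearMap.adjoint_inner_left,
      ContinuousLinearMap.isSelfAdjoint_iff'.1 (multiplier_isSelfAdjoint Λ hm), norm_inner_symm]
  have h2 : ∀ i, kernel (trialOp Λ m hh) x x i i =
      ((∫ z, ‖h z‖ ^ 2 * ∑ j, ‖convKernel Λ m i j (x - z)‖ ^ 2 : ℝ) : ℂ) := by
    intro i
    have h3 := norm_sq_localize hh (multiplier Λ m (evalVec Λ x i))
    simp only [h1] at h3
    rw [← h3, kernel, Matrix.of_apply, trialOp, inner_gram, Complex.ofReal_pow]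
    exact inner_self_eq_norm_sq_to_K (𝕜 := ℂ) _
  have h4 : ∀ i, Integrable fun z => ‖h z‖ ^ 2 * ∑ j, ‖convKernel Λ m i j (x - z)‖ ^ 2 := by
    intro i
    have h3 := integrable_localize hh (multiplier Λ m (evalVec Λ x i))
    simpa only [h1] using h3
  rw [density, Matrix.trace]
  simp only [Matrix.diag_apply, h2]
  rw [← Complex.ofReal_sum, ← integral_finsetSum _ fun i _ => h4 i]
  congr 1
  refine integral_congr_ae (.of_forall fun z => ?_)
  simp only [kernelDensity]
  rw [← Finset.mul_sum, Finset.sum_comm]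

end

/-! ## Fourier transforms of integrable functions -/

theorem norm_fourier_le {f : R3 → ℂ} (ξ : R3) : ‖𝓕 f ξ‖ ≤ ∫ x, ‖f x‖ :=
  VectorFourier.norm_fourierIntegral_le_integral_norm _ _ _ _ _

theorem continuous_fourier {f : R3 → ℂ} (hf : Integrable f) : Continuous (𝓕 f) := by
  refine VectorFourier.fourierIntegral_continuous Real.continuous_fourierChar (L := innerₗ R3) ?_ hf
  simp only [innerₗ_apply_apply]
  fun_prop

theorem isFourierOf_fourier {f : R3 → ℂ} (hf : Integrable f) : IsFourierOf f (𝓕 f) := by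
  have hc : Continuous fun p : R3 × R3 => (innerₗ R3) p.1 p.2 := by
    simp only [innerₗ_apply_apply]
    fun_prop
  intro φ
  refine ⟨?_, ?_, ?_⟩
  · obtain ⟨C, hC⟩ := φ.toBoundedContinuousFunction.isBounded_range.exists_norm_le
    exact hf.mul_bdd (c := C) φ.continuous.aestronglyMeasurable (.of_forall fun x => hC _ ⟨x, rfl⟩)
  · exact φ.integrable.bdd_mul (c := ∫ x, ‖f x‖) (continuous_fourier hf).aestronglyMeasurable
      (.of_forall norm_fourier_le)
  · have h6 := VectorFourier.integral_fourierIntegral_smul_eq_flip (L := innerₗ R3)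
      (μ := volume) (ν := volume) Real.continuous_fourierChar hc hf φ.integrable
    have h7 : (innerₗ R3).flip = innerₗ R3 := by
      ext x y
      simp
    rw [h7] at h6
    rw [SchwartzMap.fourier_coe]
    exact h6.symm

/-- `hat` is an arbitrary choice, but the distributional transform is unique almost everywhere, so
Coulomb integrals may use the ordinary Fourier integral. -/
theorem hat_ae_eq {f : R3 → ℂ} (hf : Integrable f) : hat f =ᵐ[volume] 𝓕 f := by
  have h : ∃ g, IsFourierOf f g := ⟨_, isFourierOf_fourier hf⟩
  have h1 : hat f = h.choose := by rw [hat, dif_pos h]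
  rw [h1]
  exact h.choose_spec.ae_eq (isFourierOf_fourier hf)

theorem coulomb_eq {f g : R3 → ℂ} (hf : Integrable f) (hg : Integrable g) :
    coulomb f g = (1 / Real.pi : ℂ) *
      ∫ ξ : R3, 𝓕 f ξ * (starRingEnd ℂ) (𝓕 g ξ) / (‖ξ‖ ^ 2 : ℝ) := by
  rw [coulomb]
  congr 1
  refine integral_congr_ae ?_
  filter_upwards [hat_ae_eq hf, hat_ae_eq hg] with ξ h1 h2
  rw [h1, h2]

theorem fourier_zero (f : R3 → ℂ) : 𝓕 f 0 = ∫ x, f x := by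
  simp [Real.fourier_eq]

/-- The Fourier transform of a function with finite first moment is Lipschitz at the origin. -/
theorem norm_fourier_sub_le {f : R3 → ℂ} (hf : Integrable f)
    (hf1 : Integrable fun x => ‖x‖ * ‖f x‖) (ξ : R3) :
    ‖𝓕 f ξ - ∫ x, f x‖ ≤ 2 * Real.pi * ‖ξ‖ * ∫ x, ‖x‖ * ‖f x‖ := by
  have h1 : Integrable fun x => Real.fourierChar (-inner ℝ x ξ) • f x :=
    (Real.fourierIntegral_convergent_iff ξ).2 hf
  rw [Real.fourier_eq, ← integral_sub h1 hf, ← integral_const_mul]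
  refine norm_integral_le_of_norm_le (hf1.const_mul _) (.of_forall fun x => ?_)
  have h2 : Real.fourierChar (-inner ℝ x ξ) • f x - f x =
      (Complex.exp (Complex.I * ((2 * Real.pi * -inner ℝ x ξ : ℝ) : ℂ)) - 1) * f x := by
    rw [Circle.smul_def, Real.fourierChar_apply, smul_eq_mul, mul_comm Complex.I]
    ring
  rw [h2, norm_mul]
  have h3 := Real.norm_exp_I_mul_ofReal_sub_one_le (x := 2 * Real.pi * -inner ℝ x ξ)
  have h4 : ‖2 * Real.pi * -inner ℝ x ξ‖ ≤ 2 * Real.pi * (‖x‖ * ‖ξ‖) := by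
    rw [norm_mul, norm_neg, Real.norm_of_nonneg (by positivity)]
    exact mul_le_mul_of_nonneg_left (norm_inner_le_norm x ξ) (by positivity)
  calc _ ≤ 2 * Real.pi * (‖x‖ * ‖ξ‖) * ‖f x‖ := by gcongr; exact h3.trans h4
    _ = _ := by ring

/-! ## Gaussians -/

/-- The square root of the Gaussian `exp (-π |x|² / R²)`. -/
def gaussAmp (R : ℝ) (x : R3) : ℂ := (Real.exp (-(Real.pi / (2 * R ^ 2)) * ‖x‖ ^ 2) : ℝ)

theorem continuous_gaussAmp (R : ℝ) : Continuous (gaussAmp R) := by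
  unfold gaussAmp
  fun_prop

theorem norm_gaussAmp_le (R : ℝ) (x : R3) : ‖gaussAmp R x‖ ≤ 1 := by
  rw [gaussAmp, Complex.norm_real, Real.norm_of_nonneg (Real.exp_pos _).le, Real.exp_le_one_iff,
    neg_mul, neg_nonpos]
  positivity

theorem memLp_gaussAmp (R : ℝ) : MemLp (gaussAmp R) ∞ (volume : Measure R3) :=
  memLp_top_of_bound (continuous_gaussAmp R).aestronglyMeasurable 1
    (.of_forall (norm_gaussAmp_le R))

theorem norm_sq_gaussAmp (R : ℝ) (x : R3) :
    ‖gaussAmp R x‖ ^ 2 = Real.exp (-(Real.pi / R ^ 2) * ‖x‖ ^ 2) := by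
  rw [gaussAmp, Complex.norm_real, Real.norm_of_nonneg (Real.exp_pos _).le, ← Real.exp_nat_mul]
  congr 1
  push_cast
  ring

theorem ofReal_norm_sq_gaussAmp (R : ℝ) : (fun x : R3 => ((‖gaussAmp R x‖ ^ 2 : ℝ) : ℂ)) =
    fun x : R3 => Complex.exp (-((Real.pi / R ^ 2 : ℝ) : ℂ) * (‖x‖ : ℂ) ^ 2) := by
  funext x
  rw [norm_sq_gaussAmp]
  push_cast
  rfl

theorem fourier_gaussian {R : ℝ} (hR : 0 < R) (ξ : R3) :
    𝓕 (fun x : R3 => ((‖gaussAmp R x‖ ^ 2 : ℝ) : ℂ)) ξ =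
      ((R ^ 3 * Real.exp (-(Real.pi * R ^ 2) * ‖ξ‖ ^ 2) : ℝ) : ℂ) := by
  have hb : 0 < Real.pi / R ^ 2 := by positivity
  have h1 : (Real.pi : ℂ) / ((Real.pi / R ^ 2 : ℝ) : ℂ) = ((R ^ 2 : ℝ) : ℂ) := by
    rw [← Complex.ofReal_div]
    congr 1
    field_simp
  have h2 : (((Module.finrank ℝ R3 : ℕ) : ℂ) / 2) = ((3 / 2 : ℝ) : ℂ) := by simp
  rw [ofReal_norm_sq_gaussAmp, fourier_gaussian_innerProductSpace (by rw [Complex.ofReal_re]; exact hb),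
    h1, h2,
    ← Complex.ofReal_cpow (by positivity), ← Real.rpow_natCast, ← Real.rpow_mul hR.le]
  rw [Complex.ofReal_mul, Complex.ofReal_exp]
  congr 2
  · norm_num
  · push_cast
    field_simp

theorem integrable_norm_sq_gaussAmp {R : ℝ} (hR : 0 < R) :
    Integrable fun x : R3 => ‖gaussAmp R x‖ ^ 2 := by
  have h1 := GaussianFourier.integrable_cexp_neg_mul_sq_norm_add (V := R3)
    (b := ((Real.pi / R ^ 2 : ℝ) : ℂ)) (by rw [Complex.ofReal_re]; positivity) 0 0
  refine h1.norm.congr (.of_forall fun x => ?_)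
  have h2 := congrFun (ofReal_norm_sq_gaussAmp R) x
  simp only at h2 ⊢
  rw [zero_mul, add_zero, ← h2, Complex.norm_real, Real.norm_of_nonneg (sq_nonneg _)]

theorem integral_norm_sq_gaussAmp {R : ℝ} (hR : 0 < R) :
    ∫ x : R3, ‖gaussAmp R x‖ ^ 2 = R ^ 3 := by
  have h1 := fourier_gaussian hR 0
  rw [fourier_zero, integral_complex_ofReal] at h1
  have h2 := Complex.ofReal_injective h1
  simpa using h2

/-! ## Radial integrals -/

theorem integral_radial (f : ℝ → ℝ) :
    ∫ x : R3, f ‖x‖ = 4 * Real.pi * ∫ y in Set.Ioi (0 : ℝ), y ^ 2 * f y := by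
  have h := integral_fun_norm_addHaar (volume : Measure R3) f
  have h2 : (volume : Measure R3).real (Metric.ball 0 1) = Real.pi * 4 / 3 := by
    rw [Measure.real, EuclideanSpace.volume_ball_fin_three]
    simp [ENNReal.toReal_ofReal (show (0:ℝ) ≤ Real.pi * 4 / 3 by positivity)]
  rw [h, h2]
  simp
  ring

theorem integrable_radial {f : ℝ → ℝ} :
    Integrable (fun x : R3 => f ‖x‖) ↔ IntegrableOn (fun y => y ^ 2 * f y) (Set.Ioi 0) := by
  rw [integrable_fun_norm_addHaar]
  simp

/-- In three dimensions the Jacobian `y²` cancels the Coulomb singularity and leaves a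
one-dimensional Gaussian. -/
theorem integrable_gaussian_div_sq {b : ℝ} (hb : 0 < b) :
    Integrable fun ξ : R3 => Real.exp (-b * ‖ξ‖ ^ 2) / ‖ξ‖ ^ 2 := by
  refine integrable_radial (f := fun y => Real.exp (-b * y ^ 2) / y ^ 2).2 ?_
  refine (integrable_exp_neg_mul_sq hb).integrableOn.congr_fun (fun y hy => ?_) measurableSet_Ioi
  have : y ≠ 0 := (Set.mem_Ioi.1 hy).ne'
  field_simp

theorem integral_gaussian_div_sq (b : ℝ) :
    ∫ ξ : R3, Real.exp (-b * ‖ξ‖ ^ 2) / ‖ξ‖ ^ 2 = 2 * Real.pi * √(Real.pi / b) := by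
  rw [integral_radial (fun y => Real.exp (-b * y ^ 2) / y ^ 2)]
  rw [setIntegral_congr_fun (g := fun y => Real.exp (-b * y ^ 2)) measurableSet_Ioi,
    integral_gaussian_Ioi]
  · ring
  · intro y hy
    have : y ≠ 0 := (Set.mem_Ioi.1 hy).ne'
    simp only
    field_simp

theorem integrable_gaussian_div {b : ℝ} (hb : 0 < b) :
    Integrable fun ξ : R3 => Real.exp (-b * ‖ξ‖ ^ 2) / ‖ξ‖ := by
  refine integrable_radial (f := fun y => Real.exp (-b * y ^ 2) / y).2 ?_
  refine (integrable_mul_exp_neg_mul_sq hb).integrableOn.congr_fun (fun y hy => ?_)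
    measurableSet_Ioi
  have : y ≠ 0 := (Set.mem_Ioi.1 hy).ne'
  field_simp

theorem integral_gaussian_div {b : ℝ} (hb : 0 < b) :
    ∫ ξ : R3, Real.exp (-b * ‖ξ‖ ^ 2) / ‖ξ‖ = 2 * Real.pi / b := by
  rw [integral_radial (fun y => Real.exp (-b * y ^ 2) / y)]
  have h := integral_rpow_mul_exp_neg_mul_rpow (p := 2) (q := 1) two_pos (by norm_num) hb
  rw [setIntegral_congr_fun (g := fun y => y ^ (1 : ℝ) * Real.exp (-b * y ^ (2 : ℝ)))
    measurableSet_Ioi, h]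
  · norm_num
    rw [Real.rpow_neg_one]
    field_simp
    norm_num
  · intro y hy
    have : y ≠ 0 := (Set.mem_Ioi.1 hy).ne'
    simp only [Real.rpow_one, Real.rpow_two]
    field_simp

/-! ## Coulomb energies of the trial density -/

/-- The trial operator `P g P` with the Gaussian `g = exp (-π |x|² / R²)`. -/
def gaussOp (Λ : ℝ) (m : C(R3, Matrix (Fin 4) (Fin 4) ℂ)) (R : ℝ) :
    cutoffSpace Λ →L[ℂ] cutoffSpace Λ :=
  trialOp Λ m (memLp_gaussAmp R)

/-- The form factor: the Fourier transform of `kernelDensity`. -/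
def formFactor (Λ : ℝ) (m : C(R3, Matrix (Fin 4) (Fin 4) ℂ)) : R3 → ℂ :=
  𝓕 fun x => (kernelDensity Λ m x : ℂ)

section

variable {Λ : ℝ} {m : C(R3, Matrix (Fin 4) (Fin 4) ℂ)}

theorem continuous_formFactor : Continuous (formFactor Λ m) :=
  continuous_fourier integrable_kernelDensity.ofReal

theorem norm_formFactor_le (ξ : R3) : ‖formFactor Λ m ξ‖ ≤ ∫ x, kernelDensity Λ m x := by
  refine (norm_fourier_le ξ).trans_eq (integral_congr_ae (.of_forall fun x => ?_))
  simp [abs_of_nonneg (kernelDensity_nonneg Λ m x)]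

theorem formFactor_zero : formFactor Λ m 0 = ((∫ x, kernelDensity Λ m x : ℝ) : ℂ) := by
  rw [formFactor, fourier_zero, integral_complex_ofReal]

/-- Only continuity at the origin is used. Within radius `δ` the error is below `w / 2`; beyond it
the trivial bound `2w` is at most `2w‖ξ‖/δ`. The loss of half is affordable because the main
interaction term has coefficient 2 and the resulting error has coefficient 1. -/
theorem exists_norm_formFactor_sub_le (hw : 0 < ∫ x, kernelDensity Λ m x) :
    ∃ δ, 0 < δ ∧ ∀ ξ, ‖formFactor Λ m ξ - ((∫ x, kernelDensity Λ m x : ℝ) : ℂ)‖ ≤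
      (∫ x, kernelDensity Λ m x) * (1 / 2 + 2 * ‖ξ‖ / δ) := by
  set w := ∫ x, kernelDensity Λ m x
  obtain ⟨δ, hδ, h⟩ := Metric.continuousAt_iff.1
    ((continuous_formFactor (Λ := Λ) (m := m)).continuousAt (x := 0)) (w / 2) (by positivity)
  refine ⟨δ, hδ, fun ξ => ?_⟩
  by_cases hξ : ‖ξ‖ < δ
  · have h1 := h (x := ξ) (by simpa using hξ)
    rw [dist_eq_norm, formFactor_zero] at h1
    have : 0 ≤ w * (2 * ‖ξ‖ / δ) := by positivity
    linarith
  · have h1 : ‖formFactor Λ m ξ - (w : ℂ)‖ ≤ w + w := by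
      refine (norm_sub_le _ _).trans (add_le_add (norm_formFactor_le ξ) ?_)
      rw [Complex.norm_real, Real.norm_of_nonneg hw.le]
    have h2 : 1 ≤ ‖ξ‖ / δ := (one_le_div hδ).2 (not_lt.1 hξ)
    have : w * 1 ≤ w * (‖ξ‖ / δ) := by gcongr
    calc _ ≤ w + w := h1
      _ ≤ w * (1 / 2) + 2 * (w * (‖ξ‖ / δ)) := by linarith
      _ = _ := by ring

variable (hm : ∀ p, (m p).IsHermitian)
include hm

theorem density_gaussOp (R : ℝ) : density (gaussOp Λ m R) =
    MeasureTheory.convolution (fun x : R3 => ((‖gaussAmp R x‖ ^ 2 : ℝ) : ℂ))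
      (fun x => (kernelDensity Λ m x : ℂ)) (ContinuousLinearMap.mul ℂ ℂ) volume := by
  funext x
  rw [gaussOp, density_trialOp hm, ← integral_complex_ofReal]
  simp [MeasureTheory.convolution]

theorem integrable_density_gaussOp {R : ℝ} (hR : 0 < R) :
    Integrable (density (gaussOp Λ m R)) := by
  rw [density_gaussOp hm]
  exact (integrable_norm_sq_gaussAmp hR).ofReal.integrable_convolution _
    integrable_kernelDensity.ofReal

theorem fourier_density_gaussOp {R : ℝ} (hR : 0 < R) (ξ : R3) :
    𝓕 (density (gaussOp Λ m R)) ξ =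
      ((R ^ 3 * Real.exp (-(Real.pi * R ^ 2) * ‖ξ‖ ^ 2) : ℝ) : ℂ) * formFactor Λ m ξ := by
  have h := Real.fourier_mul_convolution_eq
    (f₁ := fun x : R3 => ((‖gaussAmp R x‖ ^ 2 : ℝ) : ℂ)) (f₂ := fun x => (kernelDensity Λ m x : ℂ))
    (integrable_norm_sq_gaussAmp hR).ofReal integrable_kernelDensity.ofReal ξ
  rw [density_gaussOp hm, ← fourier_gaussian hR]
  exact h

/-- The form factor is bounded by `w`, leaving the Coulomb energy of a pure Gaussian. -/
theorem norm_coulomb_density_self_le {R : ℝ} (hR : 0 < R) :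
    ‖coulomb (density (gaussOp Λ m R)) (density (gaussOp Λ m R))‖ ≤
      √2 * (∫ x, kernelDensity Λ m x) ^ 2 * R ^ 5 := by
  have hi := integrable_density_gaussOp (Λ := Λ) hm hR
  set w := ∫ x, kernelDensity Λ m x
  have hb : 0 < 2 * Real.pi * R ^ 2 := by positivity
  have h1 : ‖∫ ξ : R3, 𝓕 (density (gaussOp Λ m R)) ξ *
      (starRingEnd ℂ) (𝓕 (density (gaussOp Λ m R)) ξ) / (‖ξ‖ ^ 2 : ℝ)‖ ≤
      ∫ ξ : R3, w ^ 2 * R ^ 6 * (Real.exp (-(2 * Real.pi * R ^ 2) * ‖ξ‖ ^ 2) / ‖ξ‖ ^ 2) := by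
    refine norm_integral_le_of_norm_le ((integrable_gaussian_div_sq hb).const_mul _)
      (.of_forall fun ξ => ?_)
    rw [norm_div, norm_mul, RCLike.norm_conj, fourier_density_gaussOp hm hR, norm_mul,
      Complex.norm_real, Complex.norm_real, Real.norm_of_nonneg (by positivity),
      Real.norm_of_nonneg (by positivity), mul_div_assoc']
    refine div_le_div_of_nonneg_right ?_ (by positivity)
    have h2 : Real.exp (-(2 * Real.pi * R ^ 2) * ‖ξ‖ ^ 2) =
        Real.exp (-(Real.pi * R ^ 2) * ‖ξ‖ ^ 2) * Real.exp (-(Real.pi * R ^ 2) * ‖ξ‖ ^ 2) := by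
      rw [← Real.exp_add]
      congr 1
      ring
    rw [h2]
    have h3 : ‖formFactor Λ m ξ‖ * ‖formFactor Λ m ξ‖ ≤ w * w :=
      mul_self_le_mul_self (norm_nonneg _) (norm_formFactor_le ξ)
    have h4 : 0 ≤ R ^ 6 * (Real.exp (-(Real.pi * R ^ 2) * ‖ξ‖ ^ 2) *
      Real.exp (-(Real.pi * R ^ 2) * ‖ξ‖ ^ 2)) := by positivity
    nlinarith [mul_le_mul_of_nonneg_left h3 h4]
  rw [coulomb_eq hi hi, norm_mul]
  rw [integral_const_mul, integral_gaussian_div_sq] at h1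
  have h5 : √(Real.pi / (2 * Real.pi * R ^ 2)) = √2 / (2 * R) := by
    rw [show Real.pi / (2 * Real.pi * R ^ 2) = (√2 / (2 * R)) ^ 2 by
      rw [div_pow, Real.sq_sqrt zero_le_two]; field_simp]
    exact Real.sqrt_sq (by positivity)
  rw [h5] at h1
  have h6 : ‖(1 / Real.pi : ℂ)‖ = 1 / Real.pi := by
    rw [norm_div, Complex.norm_real, Real.norm_of_nonneg Real.pi_pos.le, norm_one]
  rw [h6]
  calc _ ≤ 1 / Real.pi * (w ^ 2 * R ^ 6 * (2 * Real.pi * (√2 / (2 * R)))) := by gcongr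
    _ = _ := by field_simp

/-- The product of the form factor and the conjugate transform of `ν` is replaced by its value `w q`
at the origin. The Gaussian weight lives on `‖ξ‖ ~ 1/R`, so the part of the error linear in `‖ξ‖`
gains a factor `1/R` over the main term. -/
theorem norm_coulomb_density_sub_le {δ : ℝ} (hδ : 0 < δ) (hw : 0 < ∫ x, kernelDensity Λ m x)
    (hF : ∀ ξ, ‖formFactor Λ m ξ - ((∫ x, kernelDensity Λ m x : ℝ) : ℂ)‖ ≤
      (∫ x, kernelDensity Λ m x) * (1 / 2 + 2 * ‖ξ‖ / δ))
    {ν : R3 → ℝ} (hν : Integrable ν) (hν1 : Integrable fun x => ‖x‖ * |ν x|)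
    {R : ℝ} (hR : 0 < R) :
    ‖coulomb (density (gaussOp Λ m R)) (fun x => (ν x : ℂ)) -
      ((2 * (∫ x, kernelDensity Λ m x) * (∫ x, ν x) * R ^ 2 : ℝ) : ℂ)‖ ≤
      (∫ x, kernelDensity Λ m x) * (|∫ x, ν x| * R ^ 2 +
        4 * ((∫ x, ‖x‖ * |ν x|) + |∫ x, ν x| / δ) * R) := by
  have hi := integrable_density_gaussOp (Λ := Λ) hm hR
  have hνc : Integrable fun x => (ν x : ℂ) := hν.ofReal
  set w := ∫ x, kernelDensity Λ m x
  set q := ∫ x, ν x with hq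
  set M := ∫ x, ‖x‖ * |ν x| with hM
  have hM0 : 0 ≤ M := integral_nonneg fun x => by positivity
  set G : R3 → ℝ := fun ξ => Real.exp (-(Real.pi * R ^ 2) * ‖ξ‖ ^ 2) with hG
  have hG0 : ∀ ξ, 0 ≤ G ξ := fun ξ => (Real.exp_pos _).le
  have hb : 0 < Real.pi * R ^ 2 := by positivity
  have hν2 : ∀ ξ, ‖𝓕 (fun x => (ν x : ℂ)) ξ - (q : ℂ)‖ ≤ 2 * Real.pi * ‖ξ‖ * M := by
    intro ξ
    have h := norm_fourier_sub_le (f := fun x => (ν x : ℂ)) hνc (by simpa using hν1) ξ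
    simpa [hq, hM, integral_complex_ofReal] using h
  have hI2 := integrable_gaussian_div_sq hb
  have hI1 := integrable_gaussian_div hb
  have hs : √(Real.pi / (Real.pi * R ^ 2)) = 1 / R := by
    rw [show Real.pi / (Real.pi * R ^ 2) = (1 / R) ^ 2 by field_simp]
    exact Real.sqrt_sq (by positivity)
  have hpt : ∀ ξ, ‖formFactor Λ m ξ * (starRingEnd ℂ) (𝓕 (fun x => (ν x : ℂ)) ξ) -
      (w * q : ℝ)‖ ≤ w * |q| / 2 + w * (2 * Real.pi * M + 2 * |q| / δ) * ‖ξ‖ := by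
    intro ξ
    have h1 : formFactor Λ m ξ * (starRingEnd ℂ) (𝓕 (fun x => (ν x : ℂ)) ξ) - (w * q : ℝ) =
        formFactor Λ m ξ * (starRingEnd ℂ) (𝓕 (fun x => (ν x : ℂ)) ξ - q) +
        (formFactor Λ m ξ - w) * q := by
      rw [map_sub, Complex.conj_ofReal]
      push_cast
      ring
    rw [h1]
    refine (norm_add_le _ _).trans ?_
    rw [norm_mul, norm_mul, RCLike.norm_conj, Complex.norm_real, Real.norm_eq_abs]
    calc _ ≤ w * (2 * Real.pi * ‖ξ‖ * M) + w * (1 / 2 + 2 * ‖ξ‖ / δ) * |q| := by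
          gcongr
          · exact norm_formFactor_le ξ
          · exact hν2 ξ
          · exact hF ξ
      _ = _ := by ring
  have hmain : (∫ ξ : R3, 𝓕 (density (gaussOp Λ m R)) ξ *
      (starRingEnd ℂ) (𝓕 (fun x => (ν x : ℂ)) ξ) / (‖ξ‖ ^ 2 : ℝ)) =
      ∫ ξ : R3, ((R ^ 3 * (G ξ / ‖ξ‖ ^ 2) : ℝ) : ℂ) *
        (formFactor Λ m ξ * (starRingEnd ℂ) (𝓕 (fun x => (ν x : ℂ)) ξ)) := by
    refine integral_congr_ae (.of_forall fun ξ => ?_)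
    simp only
    rw [fourier_density_gaussOp hm hR]
    push_cast [hG]
    ring
  have hint : Integrable fun ξ : R3 => ((R ^ 3 * (G ξ / ‖ξ‖ ^ 2) : ℝ) : ℂ) *
        (formFactor Λ m ξ * (starRingEnd ℂ) (𝓕 (fun x => (ν x : ℂ)) ξ)) := by
    refine (hI2.const_mul _).ofReal.mul_bdd (c := w * ∫ x, ‖(ν x : ℂ)‖)
      (continuous_formFactor.mul
        (Complex.continuous_conj.comp (continuous_fourier hνc))).aestronglyMeasurable
      (.of_forall fun ξ => ?_)
    rw [norm_mul, RCLike.norm_conj]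
    gcongr
    · exact norm_formFactor_le ξ
    · exact norm_fourier_le ξ
  have hint2 : Integrable fun ξ : R3 => ((R ^ 3 * (G ξ / ‖ξ‖ ^ 2) : ℝ) : ℂ) * ((w * q : ℝ) : ℂ) :=
    (hI2.const_mul _).ofReal.mul_const _
  have hval : (∫ ξ : R3, ((R ^ 3 * (G ξ / ‖ξ‖ ^ 2) : ℝ) : ℂ) * ((w * q : ℝ) : ℂ)) =
      ((Real.pi * (2 * w * q * R ^ 2) : ℝ) : ℂ) := by
    rw [integral_mul_const, integral_complex_ofReal, integral_const_mul,
      integral_gaussian_div_sq, hs, ← Complex.ofReal_mul]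
    congr 1
    field_simp
  have hbound : ‖(∫ ξ : R3, 𝓕 (density (gaussOp Λ m R)) ξ *
      (starRingEnd ℂ) (𝓕 (fun x => (ν x : ℂ)) ξ) / (‖ξ‖ ^ 2 : ℝ)) -
      ((Real.pi * (2 * w * q * R ^ 2) : ℝ) : ℂ)‖ ≤
      ∫ ξ : R3, (R ^ 3 * (w * |q| / 2) * (G ξ / ‖ξ‖ ^ 2) +
        R ^ 3 * (w * (2 * Real.pi * M + 2 * |q| / δ)) * (G ξ / ‖ξ‖)) := by
    rw [hmain, ← hval, ← integral_sub hint hint2]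
    refine norm_integral_le_of_norm_le ((hI2.const_mul _).add (hI1.const_mul _))
      (.of_forall fun ξ => ?_)
    rw [← mul_sub, norm_mul, Complex.norm_real, Real.norm_of_nonneg (by have := hG0 ξ; positivity)]
    refine (mul_le_mul_of_nonneg_left (hpt ξ) (by have := hG0 ξ; positivity)).trans_eq ?_
    -- At the origin both sides vanish by the convention `x / 0 = 0`.
    rcases eq_or_ne ‖ξ‖ 0 with h0 | h0
    · simp [h0]
    · field_simp
  rw [integral_add (hI2.const_mul _) (hI1.const_mul _), integral_const_mul, integral_const_mul,
    integral_gaussian_div_sq, integral_gaussian_div hb, hs] at hbound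
  rw [coulomb_eq hi hνc]
  have hpi : (Real.pi : ℂ) ≠ 0 := by exact_mod_cast Real.pi_ne_zero
  have h7 : ((2 * w * q * R ^ 2 : ℝ) : ℂ) =
      (1 / Real.pi : ℂ) * ((Real.pi * (2 * w * q * R ^ 2) : ℝ) : ℂ) := by
    rw [Complex.ofReal_mul Real.pi]
    field_simp
  have h6 : ‖(1 / Real.pi : ℂ)‖ = 1 / Real.pi := by
    rw [norm_div, Complex.norm_real, Real.norm_of_nonneg Real.pi_pos.le, norm_one]
  rw [h7, ← mul_sub, norm_mul, h6]
  refine (mul_le_mul_of_nonneg_left hbound (by positivity)).trans ?_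
  have h8 : 1 / Real.pi * (R ^ 3 * (w * |q| / 2) * (2 * Real.pi * (1 / R)) +
      R ^ 3 * (w * (2 * Real.pi * M + 2 * |q| / δ)) * (2 * Real.pi / (Real.pi * R ^ 2))) =
      w * (|q| * R ^ 2 + 4 * (M + |q| / δ / Real.pi) * R) := by
    field_simp
    ring
  rw [h8]
  -- The factor `1/π` on the `δ` term is discarded for a simpler constant.
  have h9 : |q| / δ / Real.pi ≤ |q| / δ :=
    div_le_self (by positivity) (by linarith [Real.pi_gt_three])
  gcongr

end

/-! ### Reversing the sign of the trial operator -/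

theorem coulomb_neg_left {f g : R3 → ℂ} (hf : Integrable f) (hg : Integrable g) :
    coulomb (-f) g = -coulomb f g := by
  have h : ∀ ξ, 𝓕 (-f) ξ = -𝓕 f ξ := fun ξ => by simp [Real.fourier_eq, integral_neg]
  rw [coulomb_eq hf.neg hg, coulomb_eq hf hg, ← mul_neg, ← integral_neg]
  simp only [h]
  congr 1
  refine integral_congr_ae (.of_forall fun ξ => ?_)
  simp only
  ring

theorem coulomb_neg_neg {f : R3 → ℂ} (hf : Integrable f) : coulomb (-f) (-f) = coulomb f f := by
  have h : ∀ ξ, 𝓕 (-f) ξ = -𝓕 f ξ := fun ξ => by simp [Real.fourier_eq, integral_neg]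
  rw [coulomb_eq hf.neg hf.neg, coulomb_eq hf hf]
  simp only [h, map_neg, neg_mul_neg]

theorem density_neg {Λ : ℝ} (Q : cutoffSpace Λ →L[ℂ] cutoffSpace Λ) :
    density (-Q) = -density Q := by
  funext x
  simp [density, Matrix.trace, kernel]

theorem genTrace_mul_neg {Λ : ℝ} (A Q : cutoffSpace Λ →L[ℂ] cutoffSpace Λ) :
    genTrace (A * -Q) = -genTrace (A * Q) := by
  rw [genTrace, genTrace, ← trace_neg]
  congr 1
  simp only [blockPP, blockNN, conj_mul_neg, neg_add]

/-! ## The symbols of the spectral projections of the free Dirac operator -/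

/-- The symbol `1 - P⁰₋(p)` of the positive spectral projection. -/
def posSymbol : C(R3, Matrix (Fin 4) (Fin 4) ℂ) := 1 - negSymbol

theorem negSymbol_mul_negSymbol : negSymbol * negSymbol = negSymbol :=
  ContinuousMap.ext negSymbol_mul_self

theorem posSymbol_mul_posSymbol : posSymbol * posSymbol = posSymbol := by
  simp [posSymbol, sub_mul, mul_sub, negSymbol_mul_negSymbol]

theorem posSymbol_isHermitian (p : R3) : (posSymbol p).IsHermitian :=
  Matrix.isHermitian_one.sub (negSymbol_isHermitian p)

theorem trace_negSymbol (p : R3) : (negSymbol p).trace = 2 := by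
  have h : (diracSymbol p).trace = 0 := by
    simp [diracSymbol, diracAlpha, diracBeta, Fin.sum_univ_three, Matrix.trace, Fin.sum_univ_four]
  simp [negSymbol, Matrix.trace_smul, Matrix.trace_sub, h]
  norm_num

theorem trace_posSymbol (p : R3) : (posSymbol p).trace = 2 := by
  have h : posSymbol p = 1 - negSymbol p := rfl
  rw [h, Matrix.trace_sub, trace_negSymbol]
  norm_num

theorem multiplier_posSymbol (Λ : ℝ) : multiplier Λ posSymbol = Ppos Λ := by
  rw [posSymbol, multiplier_sub, multiplier_one]
  rfl

theorem Pneg_isSelfAdjoint (Λ : ℝ) : IsSelfAdjoint (Pneg Λ) :=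
  multiplier_isSelfAdjoint Λ negSymbol_isHermitian

theorem Ppos_isSelfAdjoint (Λ : ℝ) : IsSelfAdjoint (Ppos Λ) := by
  rw [← multiplier_posSymbol]
  exact multiplier_isSelfAdjoint Λ posSymbol_isHermitian

theorem gaussOp_nonneg (Λ : ℝ) (m : C(R3, Matrix (Fin 4) (Fin 4) ℂ)) (R : ℝ) :
    0 ≤ gaussOp Λ m R :=
  gram_nonneg _

theorem gaussOp_isSelfAdjoint (Λ : ℝ) (m : C(R3, Matrix (Fin 4) (Fin 4) ℂ)) (R : ℝ) :
    IsSelfAdjoint (gaussOp Λ m R) :=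
  gram_isSelfAdjoint _

/-- The projection dominates a trial operator, which is nonnegative; the scale 1 is arbitrary. -/
theorem Pneg_nonneg (Λ : ℝ) : 0 ≤ Pneg Λ :=
  (gaussOp_nonneg Λ negSymbol 1).trans
    (trialOp_le _ negSymbol_isHermitian negSymbol_mul_negSymbol (norm_gaussAmp_le 1))

theorem Ppos_nonneg (Λ : ℝ) : 0 ≤ Ppos Λ := by
  rw [← multiplier_posSymbol]
  exact (gaussOp_nonneg Λ posSymbol 1).trans
    (trialOp_le _ posSymbol_isHermitian posSymbol_mul_posSymbol (norm_gaussAmp_le 1))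

theorem gaussOp_mem_variationalSet (Λ : ℝ) {R : ℝ} (hR : 0 < R) :
    gaussOp Λ posSymbol R ∈ variationalSet Λ := by
  have hi := integrable_norm_sq_gaussAmp hR
  refine ⟨⟨isHilbertSchmidt_trialOp _ hi, isTraceClass_conj_trialOp _ hi (Ppos_isSelfAdjoint Λ),
    isTraceClass_conj_trialOp _ hi (Pneg_isSelfAdjoint Λ)⟩, gaussOp_isSelfAdjoint _ _ _, ?_, ?_⟩
  · exact (neg_nonpos.2 (Pneg_nonneg Λ)).trans (gaussOp_nonneg _ _ _)
  · change _ ≤ Ppos Λ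
    rw [← multiplier_posSymbol]
    exact trialOp_le _ posSymbol_isHermitian posSymbol_mul_posSymbol (norm_gaussAmp_le R)

theorem neg_gaussOp_mem_variationalSet (Λ : ℝ) {R : ℝ} (hR : 0 < R) :
    -gaussOp Λ negSymbol R ∈ variationalSet Λ := by
  have hi := integrable_norm_sq_gaussAmp hR
  have h1 : gaussOp Λ negSymbol R ≤ Pneg Λ :=
    trialOp_le _ negSymbol_isHermitian negSymbol_mul_negSymbol (norm_gaussAmp_le R)
  have h2 : IsTraceClass (blockPP (-gaussOp Λ negSymbol R)) :=
    (isTraceClass_conj_trialOp _ hi (Ppos_isSelfAdjoint Λ)).conj_neg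
  have h3 : IsTraceClass (blockNN (-gaussOp Λ negSymbol R)) :=
    (isTraceClass_conj_trialOp _ hi (Pneg_isSelfAdjoint Λ)).conj_neg
  have h4 : IsHilbertSchmidt (-gaussOp Λ negSymbol R) := (isHilbertSchmidt_trialOp _ hi).neg
  have h5 : IsSelfAdjoint (-gaussOp Λ negSymbol R) := neg_gram_isSelfAdjoint _
  have h6 : -gaussOp Λ negSymbol R ≤ 0 := neg_nonpos.2 (gaussOp_nonneg _ _ _)
  exact ⟨⟨h4, h2, h3⟩, h5, neg_le_neg h1, h6.trans (Ppos_nonneg Λ)⟩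

/-! ## The energy of the trial operator -/

theorem two_mul_volume_freqBall {Λ : ℝ} (hΛ : 0 < Λ) :
    2 * volume.real (freqBall Λ) = Λ ^ 3 / (3 * Real.pi ^ 2) := by
  rw [freqBall, Measure.real, EuclideanSpace.volume_closedBall_fin_three, ENNReal.toReal_mul,
    ENNReal.toReal_pow, ENNReal.toReal_ofReal (by positivity), ENNReal.toReal_ofReal (by positivity)]
  field_simp
  norm_num

section

variable {Λ : ℝ} (hΛ : 0 < Λ) {m : C(R3, Matrix (Fin 4) (Fin 4) ℂ)}
  (hm : ∀ p, (m p).IsHermitian) (hm2 : m * m = m) (htr : ∀ p, (m p).trace = 2)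
include hΛ hm hm2 htr

/-- `C` and `δ` are fixed before `ν`, so the bounds may be applied to `Z ν` for every `Z` with the
same constants. -/
theorem exists_trial_bounds : ∃ C δ : ℝ, 0 ≤ C ∧ 0 < δ ∧ ∀ (ν : R3 → ℝ), Integrable ν →
    Integrable (fun x => ‖x‖ * |ν x|) → ∀ R : ℝ, 0 < R →
    |(genTrace (dirac Λ * gaussOp Λ m R)).re| ≤ C * R ^ 3 ∧
    (coulomb (density (gaussOp Λ m R)) (density (gaussOp Λ m R))).re ≤
      √2 * (Λ ^ 3 / (3 * Real.pi ^ 2)) ^ 2 * R ^ 5 ∧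
    |(coulomb (density (gaussOp Λ m R)) (fun x => (ν x : ℂ))).re -
      2 * (Λ ^ 3 / (3 * Real.pi ^ 2)) * (∫ x, ν x) * R ^ 2| ≤
      (Λ ^ 3 / (3 * Real.pi ^ 2)) * (|∫ x, ν x| * R ^ 2 +
        4 * ((∫ x, ‖x‖ * |ν x|) + |∫ x, ν x| / δ) * R) := by
  obtain ⟨C, hC, hC'⟩ := exists_norm_genTrace_mul_trialOp_le Λ m
  have hw := integral_kernelDensity (Λ := Λ) hm hm2 htr
  rw [two_mul_volume_freqBall hΛ] at hw
  have hw0 : 0 < ∫ x, kernelDensity Λ m x := by rw [hw]; positivity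
  obtain ⟨δ, hδ, hF⟩ := exists_norm_formFactor_sub_le hw0
  refine ⟨C, δ, hC, hδ, fun ν hν hν1 R hR => ⟨?_, ?_, ?_⟩⟩
  · refine (Complex.abs_re_le_norm _).trans ?_
    have h := hC' (memLp_gaussAmp R) (integrable_norm_sq_gaussAmp hR)
    rwa [integral_norm_sq_gaussAmp hR] at h
  · rw [← hw]
    exact (Complex.re_le_norm _).trans (norm_coulomb_density_self_le hm hR)
  · have h := norm_coulomb_density_sub_le hm hδ hw0 hF hν hν1 hR
    have h2 := (Complex.abs_re_le_norm _).trans h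
    rwa [Complex.sub_re, Complex.ofReal_re, hw] at h2

end

/-! ### Comparison with `c₁` and choice of scale -/

theorem c₁_mul_rpow_le {Λ : ℝ} (hΛ : 0 < Λ) :
    c₁ * Λ * (2 * (Λ ^ 3 / (3 * Real.pi ^ 2))) ^ (5 / 3 : ℝ) ≤
      (Λ ^ 3 / (3 * Real.pi ^ 2)) ^ 2 / 2 := by
  have hπ := Real.pi_pos
  set x := 2 * (Λ ^ 3 / (3 * Real.pi ^ 2)) with hx
  have hx0 : 0 < x := by positivity
  have h1 : x ^ (-1 / 3 : ℝ) =
      (2 : ℝ) ^ (-1 / 3 : ℝ) * Λ⁻¹ * (3 : ℝ) ^ (1 / 3 : ℝ) * Real.pi ^ (2 / 3 : ℝ) := by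
    have h2 : x = 2 * Λ ^ (3 : ℝ) * (3 : ℝ) ^ (-1 : ℝ) * Real.pi ^ (-2 : ℝ) := by
      rw [hx, Real.rpow_neg_one, Real.rpow_neg hπ.le]
      norm_cast
      field_simp
    rw [h2, Real.mul_rpow (by positivity) (by positivity), Real.mul_rpow (by positivity)
      (by positivity), Real.mul_rpow (by positivity) (by positivity), ← Real.rpow_mul hΛ.le,
      ← Real.rpow_mul (by norm_num), ← Real.rpow_mul hπ.le, ← Real.rpow_neg_one Λ]
    norm_num
  have h3 : x ^ (5 / 3 : ℝ) = x ^ 2 * x ^ (-1 / 3 : ℝ) := by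
    rw [← Real.rpow_natCast, ← Real.rpow_add hx0]
    norm_num
  have h4 : (2 : ℝ) ^ (-23 / 3 : ℝ) * (2 : ℝ) ^ (-1 / 3 : ℝ) = 1 / 256 := by
    rw [← Real.rpow_add two_pos]
    norm_num
  have h5 : (3 : ℝ) ^ (1 / 3 : ℝ) * (3 : ℝ) ^ (1 / 3 : ℝ) = (3 : ℝ) ^ (2 / 3 : ℝ) := by
    rw [← Real.rpow_add three_pos]
    norm_num
  have h6 : Real.pi ^ (-4 / 3 : ℝ) * Real.pi ^ (2 / 3 : ℝ) = (Real.pi ^ (2 / 3 : ℝ))⁻¹ := by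
    rw [← Real.rpow_add hπ, ← Real.rpow_neg hπ.le]
    norm_num
  have h7 : (3 : ℝ) ^ (2 / 3 : ℝ) * (Real.pi ^ (2 / 3 : ℝ))⁻¹ ≤ 1 := by
    rw [← div_eq_mul_inv, div_le_one (by positivity)]
    exact Real.rpow_le_rpow (by norm_num) Real.pi_gt_three.le (by norm_num)
  rw [h3, h1]
  calc c₁ * Λ * (x ^ 2 * ((2 : ℝ) ^ (-1 / 3 : ℝ) * Λ⁻¹ * (3 : ℝ) ^ (1 / 3 : ℝ) *
        Real.pi ^ (2 / 3 : ℝ)))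
      = x ^ 2 * (Λ * Λ⁻¹) * ((2 : ℝ) ^ (-23 / 3 : ℝ) * (2 : ℝ) ^ (-1 / 3 : ℝ)) *
        (((3 : ℝ) ^ (1 / 3 : ℝ) * (3 : ℝ) ^ (1 / 3 : ℝ)) *
          (Real.pi ^ (-4 / 3 : ℝ) * Real.pi ^ (2 / 3 : ℝ))) := by rw [c₁]; ring
    _ = x ^ 2 / 256 * ((3 : ℝ) ^ (2 / 3 : ℝ) * (Real.pi ^ (2 / 3 : ℝ))⁻¹) := by
        rw [h4, h5, h6, mul_inv_cancel₀ hΛ.ne']; ring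
    _ ≤ x ^ 2 / 256 * 1 := by gcongr
    -- Here `x = 2w`, so the left side is `w² / 64`, well below the required `w² / 2`.
    _ ≤ _ := by rw [hx]; nlinarith [sq_nonneg (Λ ^ 3 / (3 * Real.pi ^ 2))]

/-- Optimisation of the scale `R` of the trial operator. -/
theorem exists_scale {Λ α s M C δ : ℝ} (hΛ : 0 < Λ) (hα : 0 < α) (hs : 0 < s) (hC : 0 ≤ C)
    (hδ : 0 < δ) (hM : 0 ≤ M) : ∃ Z₁ : ℝ, 0 < Z₁ ∧ ∀ Z, Z₁ < Z → ∃ R, 0 < R ∧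
      C * R ^ 3 - α * (Λ ^ 3 / (3 * Real.pi ^ 2)) * (s * Z * R ^ 2 - 4 * (Z * M + s * Z / δ) * R) +
        α / 2 * (√2 * (Λ ^ 3 / (3 * Real.pi ^ 2)) ^ 2 * R ^ 5) ≤
      -(c₁ / 2) * α * Λ * s ^ (5 / 3 : ℝ) * Z ^ (5 / 3 : ℝ) := by
  have hc := c₁_mul_rpow_le hΛ
  set w := Λ ^ 3 / (3 * Real.pi ^ 2)
  have hw : 0 < w := by positivity
  -- `A` and `B` are normalised so that, after factoring out `α w² R³`, the kinetic term becomes `A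
  -- / 2` and the linear correction `B R / 2`.
  set A := 2 * C / (α * w ^ 2) with hA
  set B := 16 * (M + s / δ) / s with hB
  have hA0 : 0 ≤ A := by positivity
  have hB0 : 0 ≤ B := by positivity
  -- For the `R` below, this threshold says exactly that `R` exceeds `1 + A + B`.
  refine ⟨2 * w * (1 + A + B) ^ 3 / s, by positivity, fun Z hZ => ?_⟩
  have hZ0 : 0 < Z := lt_trans (by positivity) hZ
  -- The trial charge `w R³` is then half of the external charge `s Z`.
  set R := (s * Z / (2 * w)) ^ (1 / 3 : ℝ) with hRdef
  have hR : 0 < R := by positivity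
  have hR3 : R ^ 3 = s * Z / (2 * w) := by
    rw [hRdef, ← Real.rpow_natCast, ← Real.rpow_mul (by positivity)]
    norm_num
  have hX : s * Z = 2 * w * R ^ 3 := by
    rw [hR3]
    field_simp
  have hRge : 1 + A + B ≤ R := by
    refine le_of_pow_le_pow_left₀ three_ne_zero hR.le ?_
    rw [hR3, le_div_iff₀ (by positivity)]
    rw [div_lt_iff₀ hs] at hZ
    linarith
  refine ⟨R, hR, ?_⟩
  have hCA : C = A * (α * w ^ 2) / 2 := by
    rw [hA]
    field_simp
  have hMB : Z * M + s * Z / δ = B * (2 * w * R ^ 3) / 16 := by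
    rw [← hX, hB]
    field_simp
  have hsZ : s ^ (5 / 3 : ℝ) * Z ^ (5 / 3 : ℝ) = (2 * w) ^ (5 / 3 : ℝ) * R ^ 5 := by
    rw [← Real.mul_rpow hs.le hZ0.le, hX, Real.mul_rpow (by positivity) (by positivity),
      ← Real.rpow_natCast R 3, ← Real.rpow_mul hR.le, ← Real.rpow_natCast R 5]
    norm_num
  have h1 : c₁ / 2 * α * Λ * s ^ (5 / 3 : ℝ) * Z ^ (5 / 3 : ℝ) ≤ α * w ^ 2 * R ^ 5 / 4 := by
    calc _ = α / 2 * R ^ 5 * (c₁ * Λ * (2 * w) ^ (5 / 3 : ℝ)) := by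
          rw [mul_assoc _ (s ^ (5 / 3 : ℝ)), hsZ]; ring
      _ ≤ α / 2 * R ^ 5 * (w ^ 2 / 2) := by gcongr
      _ = _ := by ring
  have h2 : √2 ≤ 3 / 2 := Real.sqrt_le_iff.2 ⟨by norm_num, by norm_num⟩
  have hK : 0 < α * w ^ 2 * R ^ 3 := by positivity
  -- Since `R ≥ 1`, `A ≤ R ≤ R²`; likewise `B ≤ R`. The coefficients of `R²` then add up to `1/2 +
  -- 1/2 - 2 + 3/4 = -1/4`.
  have h3 : A ≤ R ^ 2 := by nlinarith
  have h4 : B * R ≤ R ^ 2 := by nlinarith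
  rw [hMB, hX]
  calc _ = α * w ^ 2 * R ^ 3 * (A / 2 + B * R / 2 - 2 * R ^ 2 + √2 / 2 * R ^ 2) := by
        rw [hCA]; ring
    _ ≤ α * w ^ 2 * R ^ 3 * (R ^ 2 / 2 + R ^ 2 / 2 - 2 * R ^ 2 + (3 / 2) / 2 * R ^ 2) := by
        gcongr
    _ = -(α * w ^ 2 * R ^ 5 / 4) := by ring
    _ ≤ _ := by linarith

/-! ### Ground-state energy for either sign of the charge -/

theorem groundEnergy_le {α Λ : ℝ} {ν : R3 → ℝ} {Z b : ℝ}
    {Q : cutoffSpace Λ →L[ℂ] cutoffSpace Λ} (hQ : Q ∈ variationalSet Λ)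
    (h : energy α Λ (fun x => Z * ν x) Q ≤ b) : groundEnergy α Λ ν Z ≤ (b : EReal) :=
  (iInf₂_le Q hQ).trans (EReal.coe_le_coe_iff.2 h)

section

variable {Λ : ℝ} (hΛ : 0 < Λ) {α : ℝ} (hα : 0 < α) {s : ℝ} (hs : 0 < s) {M : ℝ} (hM : 0 ≤ M)
include hΛ hα hs hM

theorem exists_groundEnergy_le_of_pos : ∃ Z₁ : ℝ, 0 < Z₁ ∧ ∀ ν : R3 → ℝ, Integrable ν →
    Integrable (fun x => ‖x‖ * |ν x|) → ∫ x, ν x = s → ∫ x, ‖x‖ * |ν x| = M → ∀ Z, Z₁ < Z →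
    groundEnergy α Λ ν Z ≤
      ((-(c₁ / 2) * α * Λ * s ^ (5 / 3 : ℝ) * Z ^ (5 / 3 : ℝ) : ℝ) : EReal) := by
  obtain ⟨C, δ, hC, hδ, H⟩ := exists_trial_bounds hΛ posSymbol_isHermitian
    posSymbol_mul_posSymbol trace_posSymbol
  obtain ⟨Z₁, hZ₁, h⟩ := exists_scale hΛ hα hs hC hδ hM
  refine ⟨Z₁, hZ₁, fun ν hν hν1 hq hνM Z hZ => ?_⟩
  have hZ0 := hZ₁.trans hZ
  obtain ⟨R, hR, hE⟩ := h Z hZ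
  refine groundEnergy_le (gaussOp_mem_variationalSet Λ hR) (le_trans ?_ hE)
  have hM' : ∫ x, ‖x‖ * |Z * ν x| = Z * M := by
    simp only [abs_mul, abs_of_pos hZ0, mul_left_comm _ Z]
    rw [integral_const_mul, hνM]
  have hi : Integrable fun x => ‖x‖ * |Z * ν x| := by
    simpa only [abs_mul, abs_of_pos hZ0, mul_left_comm _ Z] using hν1.const_mul Z
  obtain ⟨h1, h2, h3⟩ := H (fun x => Z * ν x) (hν.const_mul Z) hi R hR
  rw [integral_const_mul, hq, hM', abs_of_pos (mul_pos hZ0 hs), mul_comm Z s] at h3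
  -- An upper bound on the energy needs the kinetic term from above and the attraction from below.
  have h1' := (abs_le.1 h1).2
  have h3' := mul_le_mul_of_nonneg_left (abs_le.1 h3).1 hα.le
  have h2' := mul_le_mul_of_nonneg_left h2 (half_pos hα).le
  simp only [energy, Complex.add_re, Complex.sub_re, Complex.re_ofReal_mul]
  rw [show (α / 2 : ℂ) = ((α / 2 : ℝ) : ℂ) by push_cast; rfl, Complex.re_ofReal_mul]
  linarith

theorem exists_groundEnergy_le_of_neg : ∃ Z₁ : ℝ, 0 < Z₁ ∧ ∀ ν : R3 → ℝ, Integrable ν →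
    Integrable (fun x => ‖x‖ * |ν x|) → ∫ x, ν x = -s → ∫ x, ‖x‖ * |ν x| = M → ∀ Z, Z₁ < Z →
    groundEnergy α Λ ν Z ≤
      ((-(c₁ / 2) * α * Λ * s ^ (5 / 3 : ℝ) * Z ^ (5 / 3 : ℝ) : ℝ) : EReal) := by
  obtain ⟨C, δ, hC, hδ, H⟩ := exists_trial_bounds hΛ negSymbol_isHermitian
    negSymbol_mul_negSymbol trace_negSymbol
  obtain ⟨Z₁, hZ₁, h⟩ := exists_scale hΛ hα hs hC hδ hM
  refine ⟨Z₁, hZ₁, fun ν hν hν1 hq hνM Z hZ => ?_⟩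
  have hZ0 := hZ₁.trans hZ
  obtain ⟨R, hR, hE⟩ := h Z hZ
  refine groundEnergy_le (neg_gaussOp_mem_variationalSet Λ hR) (le_trans ?_ hE)
  have hM' : ∫ x, ‖x‖ * |Z * ν x| = Z * M := by
    simp only [abs_mul, abs_of_pos hZ0, mul_left_comm _ Z]
    rw [integral_const_mul, hνM]
  have hi : Integrable fun x => ‖x‖ * |Z * ν x| := by
    simpa only [abs_mul, abs_of_pos hZ0, mul_left_comm _ Z] using hν1.const_mul Z
  obtain ⟨h1, h2, h3⟩ := H (fun x => Z * ν x) (hν.const_mul Z) hi R hR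
  rw [integral_const_mul, hq, hM', mul_neg, abs_neg, abs_of_pos (mul_pos hZ0 hs),
    mul_comm Z s] at h3
  -- The trial operator is negated, so the opposite halves of the two-sided bounds are needed; the
  -- self-energy is even and keeps its bound.
  have h1' := (abs_le.1 h1).1
  have h3' := mul_le_mul_of_nonneg_left (abs_le.1 h3).2 hα.le
  have h2' := mul_le_mul_of_nonneg_left h2 (half_pos hα).le
  have hρ := integrable_density_gaussOp (Λ := Λ) negSymbol_isHermitian hR
  have hνc : Integrable fun x => ((Z * ν x : ℝ) : ℂ) := (hν.const_mul Z).ofReal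
  rw [energy, density_neg, genTrace_mul_neg, coulomb_neg_neg hρ, coulomb_neg_left hρ hνc]
  simp only [Complex.add_re, Complex.sub_re, Complex.neg_re, Complex.re_ofReal_mul]
  rw [show (α / 2 : ℂ) = ((α / 2 : ℝ) : ℂ) by push_cast; rfl, Complex.re_ofReal_mul]
  linarith

theorem exists_groundEnergy_le : ∃ Z₁ : ℝ, 0 < Z₁ ∧ ∀ ν : R3 → ℝ, Integrable ν →
    Integrable (fun x => ‖x‖ * |ν x|) → |∫ x, ν x| = s → ∫ x, ‖x‖ * |ν x| = M → ∀ Z, Z₁ < Z →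
    groundEnergy α Λ ν Z ≤
      ((-(c₁ / 2) * α * Λ * s ^ (5 / 3 : ℝ) * Z ^ (5 / 3 : ℝ) : ℝ) : EReal) := by
  obtain ⟨Z₁, h1, H1⟩ := exists_groundEnergy_le_of_pos hΛ hα hs hM
  obtain ⟨Z₂, h2, H2⟩ := exists_groundEnergy_le_of_neg hΛ hα hs hM
  refine ⟨max Z₁ Z₂, lt_max_of_lt_left h1, fun ν hν hν1 hq hνM Z hZ => ?_⟩
  rcases eq_or_eq_neg_of_abs_eq hq with h | h
  · exact H1 ν hν hν1 h hνM Z ((le_max_left _ _).trans_lt hZ)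
  · exact H2 ν hν hν1 h hνM Z ((le_max_right _ _).trans_lt hZ)

end

end RBDF

end

theorem proposition3p2 :
    ∃ Z₁ : ℝ → ℝ → ℝ → ℝ → ℝ, (∀ Λ α s M : ℝ, 0 < Z₁ Λ α s M) ∧
      ∀ (α Λ : ℝ), 0 < α → 0 < Λ → ∀ ν : RBDF.R3 → ℝ,
        RBDF.IsCoulomb (fun x => (ν x : ℂ)) →
        MeasureTheory.Integrable ν →
        MeasureTheory.Integrable (fun x => ‖x‖ * |ν x|) →
        (∫ x, |ν x|) = 1 →
        (∫ x, ν x) ≠ 0 →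
        ∀ Z : ℝ, Z₁ Λ α |∫ x, ν x| (∫ x, ‖x‖ * |ν x|) < Z →
          RBDF.groundEnergy α Λ ν Z ≤
            ((-(RBDF.c₁ / 2) * α * Λ * |∫ x, ν x| ^ (5 / 3 : ℝ) * Z ^ (5 / 3 : ℝ) : ℝ) : EReal) := by
  have H : ∀ Λ α s M : ℝ, ∃ Z₁ : ℝ, 0 < Z₁ ∧ (0 < Λ → 0 < α → 0 < s → 0 ≤ M →
      ∀ ν : RBDF.R3 → ℝ, MeasureTheory.Integrable ν →
      MeasureTheory.Integrable (fun x => ‖x‖ * |ν x|) → |∫ x, ν x| = s →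
      ∫ x, ‖x‖ * |ν x| = M → ∀ Z, Z₁ < Z → RBDF.groundEnergy α Λ ν Z ≤
        ((-(RBDF.c₁ / 2) * α * Λ * s ^ (5 / 3 : ℝ) * Z ^ (5 / 3 : ℝ) : ℝ) : EReal)) := by
    intro Λ α s M
    by_cases h : 0 < Λ ∧ 0 < α ∧ 0 < s ∧ 0 ≤ M
    · obtain ⟨Z₁, h1, H⟩ := RBDF.exists_groundEnergy_le h.1 h.2.1 h.2.2.1 h.2.2.2
      exact ⟨Z₁, h1, fun _ _ _ _ => H⟩
    -- Outside the admissible parameters the value 1 only keeps the threshold function positive.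
    · exact ⟨1, one_pos, fun a b c d => absurd ⟨a, b, c, d⟩ h⟩
  choose Z₁ h1 H using H
  refine ⟨Z₁, h1, fun α Λ hα hΛ ν _ hν hν1 _ hq Z hZ => ?_⟩
  exact H Λ α _ _ hΛ hα (abs_pos.2 hq) (MeasureTheory.integral_nonneg fun x => by positivity) ν hν
    hν1 rfl rfl Z hZ
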